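/- Let $N\ge 1$ base stations have measurable cells $\mathcal C_1,\dots,\mathcal C_N\subset\mathbb R^2$ of finite area, let $\mathcal C=\bigcup_j\mathcal C_j$, and for $s\subseteq\{1,\dots,N\}$ let $\mathcal C(s)\subseteq\mathcal C$ be the region covered by the stations of $s$ and by no other. Content $i\in\{1,\dots,M\}$ is requested according to a homogeneous Poisson process on $\mathcal C\times(0,\infty)$ (space and time) with intensity $\lambda_i\ge 0$, independently over $i$. Each station stores exactly $K<M$ contents; $\mathcal B$ is the set of $0$-$1$ matrices $B\in\{0,1\}^{M\times N}$ with all column sums equal to $K$, where $B_{i,j}=1$ means that station $j$ stores content $i$. The hit rate $h(B)$ is the expected number of requests per unit time that are made from the cell of some station storing the requested content. Virtual caches. Let $\beta_0>0$ satisfy $\beta_0N\bigl(\max_{\mathcal B} h-\min_{\mathcal B} h\bigr)<1$ and $\beta_0\max_{\mathcal B} h<1$, and let $\beta_t=\beta_0\log(1+\lfloor t/N\rfloor)$. Let $\hat\theta(j,i,s,t)$ be random estimates, used by station $j$ in slot $t$, of $\lambda_i|\mathcal C(s)|$. From an arbitrary $V(0)\in\mathcal B$, the process $V(t)$ evolves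 as follows: in slot $t\ge1$, conditionally on the information available before the update (which includes the estimates of slot $t$ and $V(0),\dots,V(t-1)$), a station $j$ is chosen uniformly at random, and $V(t)=A$ with probability proportional to $$\exp\Bigl(\beta_t\sum_{n:\,\mathcal C_n\cap\mathcal C_j\ne\emptyset}\ \sum_{s\ni j}\ \sum_{i=1}^M\hat\theta(j,i,s,t)\frac{A_{i,n}\mathbf 1\{n\in s\}}{\max\{1,\sum_{k\in s}A_{i,k}\}}\Bigr)$$ among the $A\in\mathcal B$ that agree with $V(t-1)$ outside column $j$. Put $V(\tau)=V(t)$ for $\tau\in[t,t+1)$. Real caches. Let $0<T_1\le T_2\le\cdots$ with $T_k\to\infty$, let $S_l=T_1+\dots+T_l$ (so $S_0=0$), let $\zeta(\tau)$ be the largest $S_l\le\tau$, and put $V(0-):=V(0)$. From an arbitrary $R(0)\in\mathcal B$, the process $R(\tau)$ changes only at requests. A request at time $\tau$ for content $i$ is served by a covering station which stores $i$ if there is one, and otherwise by some covering station. If the serving station $j$ does not store $i$, it stores it if and only if $V_{i,j}(\zeta(\tau)-)=1$, and then it removes some content $k\ne i$ of its real cache with $V_{k,j}(\zeta(\tau)-)=0$.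 Assume that $\bigl|\mathcal C_j\setminus\bigcup_{n\ne j}\mathcal C_n\bigr|>0$ for every $j$; that $\hat\theta(j,i,s,t)\to\lambda_i|\mathcal C(s)|$ almost surely as $t\to\infty$, for all $j,i,s$; and that $\arg\max_{B\in\mathcal B}h(B)$ is unique. Then $$\lim_{T\to\infty}\frac1T\int_0^T\mathbf P\bigl(R(\tau)=\arg\max_{B\in\mathcal B}h(B)\bigr)\,d\tau=1 \quad\text{and}\quad \lim_{T\to\infty}\frac1T\int_0^T\mathbf E\bigl(h(R(\tau))\bigr)\,d\tau=\max_{B\in\mathcal B}h(B).$$ -/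

import Mathlib

open MeasureTheory ProbabilityTheory Filter Topology
open scoped NNReal ENNReal

namespace CellularCaching

noncomputable section

/-- The two-dimensional Euclidean space in which base stations and users are located. -/
abbrev Plane : Type := EuclideanSpace ℝ (Fin 2)

/-- A feasible configuration of the caches of `N` base stations, with `M` contents and `K` contents
per cache: `B.1 j` is the set of contents stored at station `j`. In matrix notation
`B_{i,j} = 1` means `i ∈ B.1 j`, and every column of the matrix sums to `K`. -/
abbrev Config (M N K : ℕ) : Type :=
  {B : Fin N → Finset (Fin M) // ∀ j, (B j).card = K}

/-- The union of all the cells. -/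
def coverage {N : ℕ} (cell : Fin N → Set Plane) : Set Plane := ⋃ j, cell j

/-- The region `C(s)` of the points that are covered by the stations in `s` and by no other one. -/
def region {N : ℕ} (cell : Fin N → Set Plane) (s : Finset (Fin N)) : Set Plane :=
  coverage cell ∩ (⋂ j ∈ s, cell j) ∩ (⋃ j ∈ sᶜ, cell j)ᶜ

/-- The area of `C(s)`. -/
def regionArea {N : ℕ} (cell : Fin N → Set Plane) (s : Finset (Fin N)) : ℝ :=
  (volume (region cell s)).toReal

/-! ### Content requests -/

/-- A content request `(i, x, τ)`: content `i` is requested at the location `x` at time `τ`. -/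
abbrev Request (M : ℕ) : Type := Fin M × Plane × ℝ

/-- The random set of points `Φ` is a Poisson point process with intensity measure `ν`, which is
supposed to have no atoms (so that the process has no multiple points and is the set of its
points): the number of points in a measurable set of finite intensity is Poisson distributed with
that intensity as mean, and the numbers of points in disjoint measurable sets are independent. -/
structure IsPoissonPointProcess {Ω X : Type*} [MeasurableSpace Ω] [MeasurableSpace X]
    (μ : Measure Ω) (ν : Measure X) (Φ : Ω → Set X) : Prop where
  measurable_count : ∀ A : Set X, MeasurableSet A → Measurable fun ω => (Φ ω ∩ A).encard
  count_law : ∀ A : Set X, MeasurableSet A → ν A ≠ ∞ → ∀ n : ℕ,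
    μ {ω | (Φ ω ∩ A).encard = (n : ℕ∞)} = poissonMeasure (ν A).toNNReal {n}
  indep_count : ∀ (n : ℕ) (A : Fin n → Set X), (∀ k, MeasurableSet (A k)) →
    Pairwise (fun k l => Disjoint (A k) (A l)) →
    iIndepFun (fun k ω => (Φ ω ∩ A k).encard) μ

/-- The intensity of the requests: requests for content `i` arrive at rate `lam i` per unit of area
and of time, inside the covered part of the plane and at positive times. A Poisson point process
with this intensity consists of independent homogeneous Poisson processes, one for each content. -/
def requestIntensity {M N : ℕ} (cell : Fin N → Set Plane) (lam : Fin M → ℝ≥0) :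
    Measure (Request M) :=
  ∑ i, (lam i : ℝ≥0∞) • (Measure.dirac i).prod
    (((volume : Measure Plane).restrict (coverage cell)).prod
      ((volume : Measure ℝ).restrict (Set.Ioi 0)))

/-! ### The hit rate and its optimization -/

/-- The requests made during the first unit of time that are cache hits when the configuration of
the caches is `B`: some station that covers the location stores the content. -/
def hitSet {M N K : ℕ} (cell : Fin N → Set Plane) (B : Config M N K) : Set (Request M) :=
  {r | r.2.2 ∈ Set.Ioc (0 : ℝ) 1 ∧ ∃ j, r.2.1 ∈ cell j ∧ r.1 ∈ B.1 j}

/-- The cache hit rate `h(B)`: the expected number of cache hits in unit time under `B`. -/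
def hitRate {Ω : Type*} [MeasurableSpace Ω] {M N K : ℕ} (μ : Measure Ω)
    (Φ : Ω → Set (Request M)) (cell : Fin N → Set Plane) (B : Config M N K) : ℝ :=
  (∫⁻ ω, ((Φ ω ∩ hitSet cell B).encard : ℝ≥0∞) ∂μ).toReal

/-- The set of maximizers of a function of the configuration. -/
def maximizers {M N K : ℕ} (h : Config M N K → ℝ) : Set (Config M N K) :=
  {B | ∀ A, h A ≤ h B}

/-! ### The virtual caches -/

/-- The neighbours of station `j`: the stations whose cells meet the cell of `j`. -/
def neighbours {N : ℕ} (cell : Fin N → Set Plane) (j : Fin N) : Finset (Fin N) :=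
  open Classical in Finset.univ.filter fun n => (cell j ∩ cell n).Nonempty

/-- `h_n(A, s)`, the hit rate seen by station `n` due to requests from `C(s)` under `A`, computed
from the values `θ i s`, which stand for `λ_i |C(s)|`. -/
def localHitRate {M N K : ℕ} (θ : Fin M → Finset (Fin N) → ℝ) (A : Config M N K)
    (n : Fin N) (s : Finset (Fin N)) : ℝ :=
  ∑ i, if i ∈ A.1 n ∧ n ∈ s then
    θ i s / (max 1 (s.filter fun k => i ∈ A.1 k).card : ℕ) else 0

/-- The Gibbs weight that station `j` gives to the configuration `A`:
`exp (β ∑_{n ∈ Ψ(j), s ∋ j} h_n(A, s))`. -/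
def gibbsWeight {M N K : ℕ} (cell : Fin N → Set Plane) (β : ℝ)
    (θ : Fin M → Finset (Fin N) → ℝ) (j : Fin N) (A : Config M N K) : ℝ :=
  Real.exp (β * ∑ n ∈ neighbours cell j, ∑ s with j ∈ s, localHitRate θ A n s)

/-- `A` and `B` agree at all stations except possibly at `j`. -/
def AgreeOff {M N K : ℕ} (j : Fin N) (A B : Config M N K) : Prop := ∀ k, k ≠ j → A.1 k = B.1 k

/-- The probability `π_β(A | B_{·,-j})` with which station `j`, using the values `θ`, moves the
virtual caches from `B` to `A`. -/
def gibbsConditional {M N K : ℕ} (cell : Fin N → Set Plane) (β : ℝ)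
    (θ : Fin M → Finset (Fin N) → ℝ) (j : Fin N) (B A : Config M N K) : ℝ :=
  open Classical in
  if AgreeOff j A B then
    gibbsWeight cell β θ j A / ∑ A' : Config M N K with AgreeOff j A' B, gibbsWeight cell β θ j A'
  else 0

/-- The probability of a move from `B` to `A` when the updating station `j` is uniformly
distributed and station `j` uses its own values `θ j i s`. -/
def updateProb {M N K : ℕ} (cell : Fin N → Set Plane) (β : ℝ)
    (θ : Fin N → Fin M → Finset (Fin N) → ℝ) (B A : Config M N K) : ℝ :=
  ∑ j, (1 / (N : ℝ)) * gibbsConditional cell β (θ j) j B A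

/-- The inverse temperature at time `t`: `β_t = β₀ log (1 + l)` for `lN ≤ t ≤ lN + N - 1`. -/
def inverseTemp (N : ℕ) (β₀ : ℝ) (t : ℕ) : ℝ := β₀ * Real.log (1 + ((t / N : ℕ) : ℝ))

/-- The virtual caches `V` follow the Gibbs sampler with inverse temperatures `β_t` and with
the estimates `θ k i s t`, used by station `k` in slot `t` in place of `λ_i |C(s)|`. Here `ℋ t` is
the information available when slot `t` is about to be processed; it contains the previous
virtual configurations and the estimates of slot `t`. The initial configuration is arbitrary. -/
structure IsVirtualCacheProcess {Ω : Type*} {mΩ : MeasurableSpace Ω} {M N K : ℕ}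
    (μ : Measure Ω) (ℋ : Filtration ℕ mΩ) (cell : Fin N → Set Plane) (β₀ : ℝ)
    (θ : Fin N → Fin M → Finset (Fin N) → ℕ → Ω → ℝ) (V : ℕ → Ω → Config M N K) : Prop where
  measurable_estimate : ∀ k i s t, Measurable[ℋ t] (θ k i s t)
  measurable_config : ∀ t A, MeasurableSet[ℋ (t + 1)] {ω | V t ω = A}
  update : ∀ t A,
    μ[Set.indicator {ω | V (t + 1) ω = A} (fun _ => (1 : ℝ)) | ℋ (t + 1)] =ᵐ[μ]
      fun ω => updateProb cell (inverseTemp N β₀ (t + 1)) (fun k i s => θ k i s (t + 1) ω)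
        (V t ω) A

/-! ### The real caches -/

/-- `S_l = T_1 + ... + T_l`, where `T_k` is written `T (k - 1)`. -/
def epoch (T : ℕ → ℝ) (l : ℕ) : ℝ := ∑ k ∈ Finset.range l, T k

/-- `ζ(τ) = S_{κ(τ)}` with `κ(τ) = sup {l | S_l ≤ τ}`. -/
def lastEpoch (T : ℕ → ℝ) (τ : ℝ) : ℝ := epoch T (sSup {l : ℕ | epoch T l ≤ τ})

/-- The slot whose virtual configuration is `V(a-)`, for the path which equals `V(t)` on
`[t, t + 1)`. At `a = 0` this is slot `0`, that is, `V(0-) = V(0)`. -/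
def leftSlot (a : ℝ) : ℕ := ⌈a⌉₊ - 1

/-- The possible changes of the real caches from `R` to `R'` when content `i` is requested at `x`
and `W` is the reference virtual configuration. The request is served by a covering station `j`,
which has the content if some covering station has it. If `j` lacks the content, it stores it if
and only if it is in its virtual cache, and then removes some content which is not. -/
def RealCacheStep {M N K : ℕ} (cell : Fin N → Set Plane) (W : Config M N K)
    (i : Fin M) (x : Plane) (R R' : Config M N K) : Prop :=
  ∃ j, x ∈ cell j ∧ ((∃ n, x ∈ cell n ∧ i ∈ R.1 n) → i ∈ R.1 j) ∧
    ((i ∈ R.1 j ∧ R' = R) ∨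
     (i ∉ R.1 j ∧ i ∉ W.1 j ∧ R' = R) ∨
     (i ∉ R.1 j ∧ i ∈ W.1 j ∧ ∃ k ∈ R.1 j, k ≠ i ∧ k ∉ W.1 j ∧
        R'.1 = Function.update R.1 j (insert i ((R.1 j).erase k))))

/-- The requests that arrive during `(a, b]`. -/
def requestsBetween {M : ℕ} (P : Set (Request M)) (a b : ℝ) : Set (Request M) :=
  {r ∈ P | r.2.2 ∈ Set.Ioc a b}

/-- The real caches `R(τ)`, `τ ≥ 0`, follow the real cache update scheme, with reference virtual
configuration `V(ζ(τ)-)`: almost surely, nothing changes while there is no request, and the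
configuration makes an admissible step at each request. (Almost surely no two requests are
simultaneous and finitely many arrive in bounded time.) The initial configuration, the choice of
the serving station among the admissible ones and the choice of the removed content among the
admissible ones are arbitrary. -/
structure IsRealCacheProcess {Ω : Type*} [MeasurableSpace Ω] {M N K : ℕ}
    (μ : Measure Ω) (cell : Fin N → Set Plane) (Φ : Ω → Set (Request M)) (T : ℕ → ℝ)
    (V : ℕ → Ω → Config M N K) (R : ℝ → Ω → Config M N K) : Prop where
  measurable_config : ∀ τ, 0 ≤ τ → ∀ B, MeasurableSet {ω | R τ ω = B}
  no_request : ∀ᵐ ω ∂μ, ∀ a τ : ℝ, 0 ≤ a → a < τ →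
    requestsBetween (Φ ω) a τ = ∅ → R τ ω = R a ω
  request : ∀ᵐ ω ∂μ, ∀ a τ : ℝ, 0 ≤ a → a < τ → ∀ (i : Fin M) (x : Plane),
    requestsBetween (Φ ω) a τ = {(i, x, τ)} →
      RealCacheStep cell (V (leftSlot (lastEpoch T τ)) ω) i x (R a ω) (R τ ω)

end

end CellularCaching

namespace CellularCaching

/-! Let o be the unique maximizer. It suffices that P(R(τ) = o) → 1: the probabilities P(R(τ) = B)
are Lipschitz in τ, the expected hit rate is a finite combination of them, and time averages inherit
limits.

Virtual caches. Column j influences only the hits in regions covered by j, so with exact rates the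
energy used by station j differs from h by a term that column j does not affect
(`stationEnergy_sub_coverageRate`). The update is therefore a Gibbs sampler for h under logarithmic
cooling, disturbed by the estimates. The estimates converge without a rate, so after multiplication
by β_t the error in the exponents need not stay bounded; it is only at most ηβ_n, for any fixed η >
0 and late slots. Transition probabilities are thus known up to a factor D = exp(2ηβ_n), and the
error may change from step to step. `exists_robust_lyapunov` builds a Lyapunov function that works
simultaneously for all kernels within a factor D of a frozen reversible one, at the price of a power
D^m with m independent of D and of the kernel.

On the slots from n/2 to n, `measureReal_ne_le` splits the event V(n) ≠ o by the last visit to o.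
With Δ the oscillation of h, having no visit costs at most order n^(β₀N(Δ+2η)) / n, which vanishes
for small η because β₀NΔ < 1. An excursion from o of length l costs at most a multiple of
exp(β_n(2η(m+1) - gap)) / l, where gap separates h(o) from the other values; summing over l gives a
negative power of n times a logarithm.

Real caches. Suppose the reference configuration is o in two consecutive epochs. A content of o
requested during the first one, at a point covered only by a station that should store it, enters
that cache and is not evicted while the reference stays o. Such contents have positive request rates
by uniqueness of o (`lam_pos_of_mem_unique_maximizer`), and the epochs grow, so with probability
tending to one all of them are requested in time (`tendsto_measureReal_real_ne`). -/

/-! ### Lyapunov functions robust under multiplicative perturbation -/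

/-- Let `k` be reversible with respect to `π`, with all states leading to `o`. There is a function
which, for all rates that agree with those of `k` up to a factor `D`, decreases at rate at least `g`
off `o`, and whose mean rate of increase at `o` is controlled by the mean of `g`. -/
theorem exists_robust_lyapunov {S : Type*} [Fintype S] [DecidableEq S] (o : S) (U : Finset S) :
    o ∉ U → ∃ m : ℕ, ∀ (D : ℝ) (k : S → S → ℝ) (π g : S → ℝ) (d : S → ℕ), 1 ≤ D →
    (∀ x y, 0 ≤ k x y) → (∀ x, 0 ≤ π x) → (∀ x, 0 ≤ g x) →
    (∀ x y, π x * k x y = π y * k y x) →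
    (∀ x ∈ U, ∃ y ∈ insert o U, d y < d x ∧ 0 < k x y) →
    ∃ w : S → ℝ, w o = 0 ∧ (∀ x, 0 ≤ w x) ∧
      (∀ x ∈ U, ∀ r : S → ℝ, (∀ y, k x y / D ≤ r y ∧ r y ≤ D * k x y) →
        g x ≤ ∑ y ∈ insert o U, r y * (w x - w y)) ∧
      π o * ∑ y ∈ U, k o y * w y ≤ D ^ m * ∑ x ∈ U, π x * g x := by
  induction U using Finset.induction_on with
  | empty =>
    intro _
    exact ⟨0, fun D k π g d _ _ _ _ _ _ => ⟨0, by simp⟩⟩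
  | insert z U hzU ih =>
    intro hoU
    have hoz : o ≠ z := fun h => hoU (by simp [h])
    have hoU' : o ∉ U := fun h => hoU (by simp [h])
    obtain ⟨m, hm⟩ := ih hoU'
    -- Eliminating one state turns the perturbation factor D into D ^ 3; the value at z and the
    -- modified cost `g'` contribute a further D ^ 2 each.
    refine ⟨3 * m + 4, ?_⟩
    intro D k π g d hD hk hπ hg hrev hd
    have hD0 : 0 < D := by linarith
    have hzI : z ∉ insert o U := by simp [hzU, hoz.symm]
    have hins : insert o (insert z U) = insert z (insert o U) := Finset.insert_comm _ _ _
    set I := insert o U with hI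
    set κ := ∑ y ∈ I, k z y with hκ
    have hκ0 : 0 < κ := by
      obtain ⟨y, hy, hdy, hky⟩ := hd z (by simp)
      have hyI : y ∈ I := by
        rw [hins, Finset.mem_insert] at hy
        rcases hy with rfl | h
        · omega
        · exact h
      exact lt_of_lt_of_le hky (Finset.single_le_sum (f := fun y => k z y)
        (fun i _ => hk z i) hyI)
    -- The chain watched only off z: a jump to z is redirected to the state by which z is left.
    -- Detailed balance with respect to π survives.
    let k' : S → S → ℝ := fun x y => k x y + k x z * k z y / κ
    -- The second term charges x for the cost incurred at z; D ^ 2 covers the errors in the rate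
    -- into z and in the total rate out of it.
    let g' : S → ℝ := fun x => g x + D ^ 2 * (k x z * g z / κ)
    have hg'0 : ∀ x, 0 ≤ g' x := fun x => by
      have := hg x; have := hg z; have := hk x z
      positivity
    obtain ⟨w, hwo, hw0, hwU, hwo'⟩ := hm (D ^ 3) k' π g' d (one_le_pow₀ hD)
      (fun x y => by have := hk x y; have := hk x z; have := hk z y; positivity) hπ hg'0
      (fun x y => by
        have h1 := hrev x y
        have h2 := hrev x z
        have h3 := hrev y z
        simp only [k']
        have : π x * (k x z * k z y / κ) = π y * (k y z * k z x / κ) := by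
          rw [← mul_div_assoc, ← mul_div_assoc, ← mul_assoc, ← mul_assoc, h2, h3]; ring
        rw [mul_add, mul_add, h1, this])
      (fun x hx => by
        obtain ⟨y, hy, hdy, hky⟩ := hd x (by simp [hx])
        rw [hins, Finset.mem_insert] at hy
        rcases hy with rfl | hy
        -- The path from x ran through the eliminated state, so its next state is now reached
        -- directly, by the second term of `k'`.
        · obtain ⟨y', hy', hdy', hky'⟩ := hd y (by simp)
          rw [hins, Finset.mem_insert] at hy'
          rcases hy' with rfl | hy'
          · omega
          · refine ⟨y', hy', by omega, ?_⟩
            have := hk x y'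
            simp only [k']
            positivity
        · refine ⟨y, hy, hdy, ?_⟩
          have := hk x z; have := hk z y
          simp only [k']
          positivity)
    let box : Set (S → ℝ) := Set.Icc (fun y => k z y / D) (fun y => D * k z y)
    have hboxsum : ∀ r ∈ box, κ / D ≤ ∑ y ∈ I, r y ∧ ∑ y ∈ I, r y ≤ D * κ := by
      intro r hr
      constructor
      · rw [hκ, Finset.sum_div]
        exact Finset.sum_le_sum fun y _ => hr.1 y
      · rw [hκ, Finset.mul_sum]
        exact Finset.sum_le_sum fun y _ => hr.2 y
    have hκD : 0 < κ / D := by positivity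
    have hne : box.Nonempty := by
      refine ⟨k z, fun y => div_le_self (hk z y) hD, fun y => le_mul_of_one_le_left (hk z y) hD⟩
    -- The value at z is the worst case over all admissible rates out of z. The drift inequality at
    -- z then holds for all of them, with equality at q.
    obtain ⟨q, hq, hqmax⟩ := (isCompact_Icc : IsCompact box).exists_isMaxOn hne
      (f := fun r : S → ℝ => (g z + ∑ y ∈ I, r y * w y) / ∑ y ∈ I, r y)
      (ContinuousOn.div (by fun_prop) (by fun_prop)
        (fun r hr => (lt_of_lt_of_le hκD (hboxsum r hr).1).ne'))
    set ρ := ∑ y ∈ I, q y with hρ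
    obtain ⟨hρ1, hρ2⟩ := hboxsum q hq
    rw [← hρ] at hρ1 hρ2
    have hρ0 : 0 < ρ := lt_of_lt_of_le hκD hρ1
    have hq0 : ∀ y, 0 ≤ q y := fun y => (div_nonneg (hk z y) hD0.le).trans (hq.1 y)
    let wz : ℝ := (g z + ∑ y ∈ I, q y * w y) / ρ
    have hwz0 : 0 ≤ wz := div_nonneg (add_nonneg (hg z)
      (Finset.sum_nonneg fun y _ => mul_nonneg (hq0 y) (hw0 y))) hρ0.le
    have hwz : wz * ρ = g z + ∑ y ∈ I, q y * w y := div_mul_cancel₀ _ hρ0.ne'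
    let w' : S → ℝ := Function.update w z wz
    have hw'z : w' z = wz := Function.update_self _ _ _
    have hw'I : ∀ y, y ≠ z → w' y = w y := fun y hy => Function.update_of_ne hy _ _
    have hneI : ∀ y ∈ I, y ≠ z := fun y hy h => hzI (h ▸ hy)
    have hinvρ : 1 / ρ ≤ D / κ := by
      rw [div_le_div_iff₀ hρ0 hκ0]
      rw [div_le_iff₀ hD0] at hρ1
      linarith
    have hinvρ' : 1 / (D * κ) ≤ 1 / ρ := one_div_le_one_div_of_le hρ0 hρ2
    refine ⟨w', by rw [hw'I o hoz, hwo], ?_, ?_, ?_⟩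
    · intro x
      by_cases hx : x = z
      · rw [hx, hw'z]; exact hwz0
      · rw [hw'I x hx]; exact hw0 x
    · intro x hx r hr
      rw [hins, Finset.sum_insert hzI]
      rw [Finset.mem_insert] at hx
      rcases hx with rfl | hx
      · rw [sub_self, mul_zero, zero_add]
        have hrb : r ∈ box := ⟨fun y => (hr y).1, fun y => (hr y).2⟩
        have h1 : (g x + ∑ y ∈ I, r y * w y) / ∑ y ∈ I, r y ≤ wz := hqmax hrb
        have hpos : 0 < ∑ y ∈ I, r y := lt_of_lt_of_le hκD (hboxsum r hrb).1
        rw [div_le_iff₀ hpos] at h1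
        have : ∑ y ∈ I, r y * (w' x - w' y) = wz * (∑ y ∈ I, r y) - ∑ y ∈ I, r y * w y := by
          rw [Finset.mul_sum, ← Finset.sum_sub_distrib]
          refine Finset.sum_congr rfl fun y hy => ?_
          rw [hw'z, hw'I y (hneI y hy)]; ring
        linarith
      · have hxz : x ≠ z := fun h => hzU (h ▸ hx)
        have hrz0 : 0 ≤ r z := (div_nonneg (hk x z) hD0.le).trans (hr z).1
        -- At x ≠ z the inductive drift is used for the rates obtained by eliminating z with the
        -- extremal exit rates q; they are within D ^ 3 of `k'`.
        have key := hwU x hx (fun y => r y + r z * (q y / ρ)) (fun y => by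
          have hxz0 := hk x z
          have hzy0 := hk z y
          have hxy0 := hk x y
          have e1 : q y / ρ ≤ D ^ 2 * (k z y / κ) := by
            calc q y / ρ = q y * (1 / ρ) := by ring
              _ ≤ (D * k z y) * (D / κ) := by
                have := hq.2 y
                gcongr
              _ = _ := by ring
          have e2 : (k z y / κ) / D ^ 2 ≤ q y / ρ := by
            calc (k z y / κ) / D ^ 2 = (k z y / D) * (1 / (D * κ)) := by field_simp
              _ ≤ q y * (1 / ρ) := by
                have := hq.1 y
                have := hq0 y
                gcongr
              _ = _ := by ring
          have D1 : D ≤ D ^ 3 := le_self_pow₀ hD (by norm_num)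
          constructor
          · calc k' x y / D ^ 3 = k x y / D ^ 3 + (k x z / D) * ((k z y / κ) / D ^ 2) := by
                  simp only [k']; field_simp
              _ ≤ r y + r z * (q y / ρ) := by
                have h1 : k x y / D ^ 3 ≤ k x y / D := by gcongr
                have h2 := (hr y).1
                have h3 := (hr z).1
                have : (k x z / D) * ((k z y / κ) / D ^ 2) ≤ r z * (q y / ρ) := by gcongr
                linarith
          · calc r y + r z * (q y / ρ) ≤ D * k x y + (D * k x z) * (D ^ 2 * (k z y / κ)) := by
                  have h2 := (hr y).2
                  have h3 := (hr z).2
                  have := hq0 y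
                  gcongr
              _ ≤ D ^ 3 * k x y + (D * k x z) * (D ^ 2 * (k z y / κ)) := by gcongr
              _ = D ^ 3 * k' x y := by simp only [k']; ring)
        have hsum : r z * (w' x - w' z) + ∑ y ∈ I, r y * (w' x - w' y)
            = ∑ y ∈ I, (r y + r z * (q y / ρ)) * (w x - w y) - r z * g z / ρ := by
          have e : ∑ y ∈ I, (r y + r z * (q y / ρ)) * (w x - w y)
              = ∑ y ∈ I, r y * (w' x - w' y) + r z / ρ * (w x * ρ - ∑ y ∈ I, q y * w y) := by
            rw [hρ, Finset.mul_sum, ← Finset.sum_sub_distrib, Finset.mul_sum,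
              ← Finset.sum_add_distrib]
            refine Finset.sum_congr rfl fun y hy => ?_
            rw [hw'I x hxz, hw'I y (hneI y hy)]; ring
          rw [e, hw'z, hw'I x hxz]
          have : ∑ y ∈ I, q y * w y = wz * ρ - g z := by linarith
          rw [this]
          field_simp
          ring
        rw [hsum]
        have : r z * g z / ρ ≤ D ^ 2 * (k x z * g z / κ) := by
          have h3 := (hr z).2
          have := hg z
          have hxz0 := hk x z
          calc r z * g z / ρ = r z * g z * (1 / ρ) := by ring
            _ ≤ (D * k x z) * g z * (D / κ) := by gcongr
            _ = _ := by ring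
        have hkey : g x + D ^ 2 * (k x z * g z / κ) ≤ _ := key
        linarith
    · rw [Finset.sum_insert hzU, Finset.sum_insert hzU, hw'z]
      have e0 : ∑ y ∈ U, k o y * w' y = ∑ y ∈ U, k o y * w y :=
        Finset.sum_congr rfl fun y hy => by rw [hw'I y (fun h => hzU (h ▸ hy))]
      have hIU : ∀ f : S → ℝ, ∑ y ∈ I, f y * w y = ∑ y ∈ U, f y * w y := fun f => by
        rw [hI, Finset.sum_insert hoU', hwo]; ring
      have b1 : wz ≤ D ^ 2 * (g z / κ + ∑ y ∈ U, k z y / κ * w y) := by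
        have hU0 : 0 ≤ ∑ y ∈ U, q y * w y :=
          Finset.sum_nonneg fun y _ => mul_nonneg (hq0 y) (hw0 y)
        have hgz := hg z
        calc wz = (g z + ∑ y ∈ U, q y * w y) * (1 / ρ) := by
              simp only [wz]; rw [hIU]; ring
          _ ≤ (D * g z + ∑ y ∈ U, (D * k z y) * w y) * (D / κ) := by
            have : g z ≤ D * g z := le_mul_of_one_le_left hgz hD
            have : ∑ y ∈ U, q y * w y ≤ ∑ y ∈ U, (D * k z y) * w y :=
              Finset.sum_le_sum fun y _ => mul_le_mul_of_nonneg_right (hq.2 y) (hw0 y)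
            have : 0 ≤ D * g z + ∑ y ∈ U, (D * k z y) * w y := by
              have : 0 ≤ D * g z := by positivity
              linarith
            gcongr
          _ = _ := by
            rw [add_mul, mul_add, Finset.sum_mul, Finset.mul_sum]
            congr 1
            · ring
            · exact Finset.sum_congr rfl fun y _ => by ring
      have hoz0 := hk o z
      have b2 : k o z * wz + ∑ y ∈ U, k o y * w' y
          ≤ D ^ 2 * (k o z * g z / κ) + D ^ 2 * ∑ y ∈ U, k' o y * w y := by
        have hA : ∑ y ∈ U, k' o y * w y
            = ∑ y ∈ U, k o y * w y + k o z * ∑ y ∈ U, k z y / κ * w y := by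
          rw [Finset.mul_sum, ← Finset.sum_add_distrib]
          exact Finset.sum_congr rfl fun y _ => by simp only [k']; ring
        have hB : 0 ≤ ∑ y ∈ U, k o y * w y :=
          Finset.sum_nonneg fun y _ => mul_nonneg (hk o y) (hw0 y)
        have hC : ∑ y ∈ U, k o y * w y ≤ D ^ 2 * ∑ y ∈ U, k o y * w y :=
          le_mul_of_one_le_left hB (one_le_pow₀ hD)
        have hE := mul_le_mul_of_nonneg_left b1 hoz0
        have hF : k o z * (D ^ 2 * (g z / κ + ∑ y ∈ U, k z y / κ * w y))
          = D ^ 2 * (k o z * g z / κ) + D ^ 2 * (k o z * ∑ y ∈ U, k z y / κ * w y) := by ring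
        rw [e0, hA]
        linarith
      have c1 : π o * (k o z * g z / κ) = π z * g z * (k z o / κ) := by
        have := hrev o z
        calc π o * (k o z * g z / κ) = (π o * k o z) * g z / κ := by ring
          _ = _ := by rw [this]; ring
      have c2 : ∑ x ∈ U, π x * g' x
          = ∑ x ∈ U, π x * g x + D ^ 2 * (π z * g z * ((∑ x ∈ U, k z x) / κ)) := by
        rw [Finset.sum_div, Finset.mul_sum, Finset.mul_sum, ← Finset.sum_add_distrib]
        refine Finset.sum_congr rfl fun x _ => ?_
        simp only [g']
        have := hrev x z
        calc π x * (g x + D ^ 2 * (k x z * g z / κ))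
            = π x * g x + D ^ 2 * ((π x * k x z) * g z / κ) := by ring
          _ = _ := by rw [this]; ring
      -- By detailed balance the mass π z * g z was charged partly through o and partly through U;
      -- the two shares add up to exactly one.
      have c3 : k z o / κ + (∑ x ∈ U, k z x) / κ = 1 := by
        rw [← add_div, div_eq_one_iff_eq hκ0.ne', hκ, hI, Finset.sum_insert hoU']
      set a := k z o / κ
      set b := (∑ x ∈ U, k z x) / κ
      have ha : 0 ≤ a := div_nonneg (hk z o) hκ0.le
      have hG : 0 ≤ π z * g z := mul_nonneg (hπ z) (hg z)
      have hS0 : 0 ≤ ∑ x ∈ U, π x * g x :=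
        Finset.sum_nonneg fun x _ => mul_nonneg (hπ x) (hg x)
      have hD3 : (D ^ 3) ^ m = D ^ (3 * m) := by rw [← pow_mul]
      rw [hD3, c2] at hwo'
      have hDm : 1 ≤ D ^ (3 * m) := one_le_pow₀ hD
      have hD2 : 1 ≤ D ^ 2 := one_le_pow₀ hD
      calc π o * (k o z * wz + ∑ y ∈ U, k o y * w' y)
          ≤ π o * (D ^ 2 * (k o z * g z / κ) + D ^ 2 * ∑ y ∈ U, k' o y * w y) :=
            mul_le_mul_of_nonneg_left b2 (hπ o)
        _ = D ^ 2 * (π o * (k o z * g z / κ)) + D ^ 2 * (π o * ∑ y ∈ U, k' o y * w y) := by ring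
        _ ≤ D ^ 2 * (π z * g z * a)
            + D ^ 2 * (D ^ (3 * m) * (∑ x ∈ U, π x * g x + D ^ 2 * (π z * g z * b))) := by
          rw [c1]; gcongr
        _ ≤ D ^ 2 * (D ^ (3 * m) * (D ^ 2 * (π z * g z * a)))
            + D ^ 2 * (D ^ (3 * m) * (D ^ 2 * (∑ x ∈ U, π x * g x) + D ^ 2 * (π z * g z * b))) := by
          have h1 : π z * g z * a ≤ D ^ (3 * m) * (D ^ 2 * (π z * g z * a)) := by
            rw [← mul_assoc]
            exact le_mul_of_one_le_left (mul_nonneg hG ha) (one_le_mul_of_one_le_of_one_le hDm hD2)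
          have h2 : ∑ x ∈ U, π x * g x ≤ D ^ 2 * (∑ x ∈ U, π x * g x) :=
            le_mul_of_one_le_left hS0 hD2
          gcongr
        _ = D ^ (3 * m + 4) * (π z * g z * (a + b) + ∑ x ∈ U, π x * g x) := by ring
        _ = _ := by rw [c3, mul_one]

/-! ### The random scan Gibbs sampler -/

section GibbsKernel

variable {M N K : ℕ}

/-- The transition probabilities of the random scan Gibbs sampler in which station `j` chooses `A`
with probability proportional to `exp (E j A)`. -/
noncomputable def gibbsKernel (E : Fin N → Config M N K → ℝ) (B A : Config M N K) : ℝ :=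
  ∑ j, (1 / (N : ℝ)) * (open Classical in
    if AgreeOff j A B then
      Real.exp (E j A) / ∑ A' : Config M N K with AgreeOff j A' B, Real.exp (E j A')
    else 0)

theorem AgreeOff.refl (j : Fin N) (A : Config M N K) : AgreeOff j A A := fun _ _ => rfl

theorem AgreeOff.symm {j : Fin N} {A B : Config M N K} (h : AgreeOff j A B) : AgreeOff j B A :=
  fun k hk => (h k hk).symm

theorem AgreeOff.trans {j : Fin N} {A B C : Config M N K} (h : AgreeOff j A B)
    (h' : AgreeOff j B C) : AgreeOff j A C :=
  fun k hk => (h k hk).trans (h' k hk)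

open Classical in
theorem gibbs_partition_pos (E : Config M N K → ℝ) (j : Fin N) (B : Config M N K) :
    0 < ∑ A' : Config M N K with AgreeOff j A' B, Real.exp (E A') :=
  Finset.sum_pos (fun _ _ => Real.exp_pos _) ⟨B, by simp [AgreeOff.refl]⟩

theorem gibbsKernel_nonneg (E : Fin N → Config M N K → ℝ) (B A : Config M N K) :
    0 ≤ gibbsKernel E B A := by
  classical
  refine Finset.sum_nonneg fun j _ => mul_nonneg (by positivity) ?_
  split_ifs with h
  · exact div_nonneg (Real.exp_pos _).le (gibbs_partition_pos (E j) j B).le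
  · exact le_rfl

theorem sum_gibbsKernel (hN : 0 < N) (E : Fin N → Config M N K → ℝ) (B : Config M N K) :
    ∑ A, gibbsKernel E B A = 1 := by
  classical
  unfold gibbsKernel
  rw [Finset.sum_comm]
  have : ∀ j : Fin N, ∑ A : Config M N K, (1 / (N : ℝ)) * (if AgreeOff j A B then
      Real.exp (E j A) / ∑ A' : Config M N K with AgreeOff j A' B, Real.exp (E j A')
      else 0) = 1 / (N : ℝ) := by
    intro j
    rw [← Finset.mul_sum, ← Finset.sum_filter, ← Finset.sum_div,
      div_self (gibbs_partition_pos (E j) j B).ne', mul_one]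
  rw [Finset.sum_congr rfl fun j _ => this j]
  have : (N : ℝ) ≠ 0 := by positivity
  simp [this]

/-- The numerator and the partition function each cost a factor exp ε. -/
theorem gibbsKernel_le_of_abs_sub_le {E E' : Fin N → Config M N K → ℝ} {ε : ℝ}
    (h : ∀ j A, |E j A - E' j A| ≤ ε) (B A : Config M N K) :
    gibbsKernel E B A ≤ Real.exp (2 * ε) * gibbsKernel E' B A := by
  classical
  unfold gibbsKernel
  rw [Finset.mul_sum]
  refine Finset.sum_le_sum fun j _ => ?_
  rw [mul_left_comm]
  refine mul_le_mul_of_nonneg_left ?_ (by positivity)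
  split_ifs with hA
  · have h1 : Real.exp (E j A) ≤ Real.exp ε * Real.exp (E' j A) := by
      rw [← Real.exp_add]
      exact Real.exp_le_exp.mpr (by linarith [(abs_le.mp (h j A)).2])
    have h2 : ∑ A' : Config M N K with AgreeOff j A' B, Real.exp (E' j A')
        ≤ Real.exp ε * ∑ A' : Config M N K with AgreeOff j A' B, Real.exp (E j A') := by
      rw [Finset.mul_sum]
      refine Finset.sum_le_sum fun A' _ => ?_
      rw [← Real.exp_add]
      exact Real.exp_le_exp.mpr (by linarith [(abs_le.mp (h j A')).1])
    have p1 := gibbs_partition_pos (E j) j B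
    have p2 := gibbs_partition_pos (E' j) j B
    rw [← mul_div_assoc, div_le_div_iff₀ p1 p2, two_mul, Real.exp_add]
    have := mul_le_mul h1 h2 p2.le (by positivity)
    linarith
  · simp

/-- Station j normalizes over configurations that agree off j, so a term of its energy that is
constant on this class cancels. This allows local energies to replace h. -/
theorem gibbsKernel_congr {E E' : Fin N → Config M N K → ℝ}
    (h : ∀ j A B, AgreeOff j A B → E j A - E' j A = E j B - E' j B) (B A : Config M N K) :
    gibbsKernel E B A = gibbsKernel E' B A := by
  classical
  unfold gibbsKernel
  refine Finset.sum_congr rfl fun j _ => ?_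
  congr 1
  split_ifs with hA
  · have e : ∀ A', AgreeOff j A' B →
        Real.exp (E j A') = Real.exp (E j B - E' j B) * Real.exp (E' j A') := fun A' hA' => by
      rw [← Real.exp_add, ← h j A' B hA', sub_add_cancel]
    rw [e A hA, Finset.sum_congr rfl fun A' hA' => e A' (Finset.mem_filter.mp hA').2,
      ← Finset.mul_sum, mul_div_mul_left _ _ (Real.exp_pos _).ne']
  · rfl

/-- Two configurations that agree off j have the same partition function at j, so each station's
summand is already symmetric. -/
theorem gibbsKernel_reversible (F : Config M N K → ℝ) (A B : Config M N K) :
    Real.exp (F A) * gibbsKernel (fun _ => F) A B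
      = Real.exp (F B) * gibbsKernel (fun _ => F) B A := by
  classical
  unfold gibbsKernel
  rw [Finset.mul_sum, Finset.mul_sum]
  refine Finset.sum_congr rfl fun j _ => ?_
  by_cases h : AgreeOff j B A
  · have hs : (Finset.univ.filter fun A' : Config M N K => AgreeOff j A' A)
        = Finset.univ.filter fun A' : Config M N K => AgreeOff j A' B :=
      Finset.filter_congr fun A' _ => ⟨fun h' => h'.trans h.symm, fun h' => h'.trans h⟩
    rw [if_pos h, if_pos h.symm, hs]
    ring
  · rw [if_neg h, if_neg fun h' => h h'.symm]
    simp

/-- Station j is chosen with probability 1 / N, and its partition function has at most as many terms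
as there are configurations, each at most exp Δ times the weight of A. -/
theorem le_gibbsKernel {F : Config M N K → ℝ} {Δ : ℝ} (hF : ∀ A B, F A - F B ≤ Δ)
    {j : Fin N} {A B : Config M N K} (hAB : AgreeOff j A B) :
    1 / (N * Fintype.card (Config M N K)) * Real.exp (-Δ) ≤ gibbsKernel (fun _ => F) B A := by
  classical
  unfold gibbsKernel
  refine le_trans ?_ (Finset.single_le_sum (f := fun j => (1 / (N : ℝ)) *
    (if AgreeOff j A B then Real.exp (F A) / ∑ A' : Config M N K with AgreeOff j A' B,
      Real.exp (F A') else 0)) (fun i _ => ?_) (Finset.mem_univ j))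
  · simp only [if_pos hAB]
    rw [one_div_mul_eq_div, div_mul_eq_div_div, div_right_comm, div_eq_mul_one_div, mul_comm]
    refine mul_le_mul_of_nonneg_left ?_ (by positivity)
    have hc : 0 < (Fintype.card (Config M N K) : ℝ) := by
      exact_mod_cast Fintype.card_pos_iff.mpr ⟨A⟩
    rw [div_le_div_iff₀ hc (gibbs_partition_pos F j B), mul_comm, ← le_div_iff₀ (Real.exp_pos _)]
    have : ∀ A' ∈ (Finset.univ.filter fun A' : Config M N K => AgreeOff j A' B),
        Real.exp (F A') ≤ Real.exp (F A) / Real.exp (-Δ) := fun A' _ => by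
      rw [← Real.exp_sub]
      exact Real.exp_le_exp.mpr (by linarith [hF A' A])
    refine (Finset.sum_le_card_nsmul _ _ _ this).trans ?_
    rw [nsmul_eq_mul, mul_comm (Real.exp (F A)), mul_div_assoc]
    refine mul_le_mul_of_nonneg_right ?_ (by positivity)
    exact_mod_cast Finset.card_filter_le _ _
  · refine mul_nonneg (by positivity) ?_
    split_ifs with h
    · exact div_nonneg (Real.exp_pos _).le (gibbs_partition_pos F i B).le
    · exact le_rfl

/-- The number of stations at which two configurations differ. -/
def configDist (o A : Config M N K) : ℕ := (Finset.univ.filter fun j => A.1 j ≠ o.1 j).card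

theorem configDist_le (o A : Config M N K) : configDist o A ≤ N :=
  (Finset.card_filter_le _ _).trans (by simp)

/-- Copying one wrong column from o is a single Gibbs move. These moves give the paths to o needed
by both Lyapunov functions. -/
theorem exists_agreeOff_configDist_lt {o A : Config M N K} (h : A ≠ o) :
    ∃ j B, AgreeOff j B A ∧ configDist o B + 1 = configDist o A := by
  obtain ⟨j, hj⟩ : ∃ j, A.1 j ≠ o.1 j := by
    by_contra! h'
    exact h (Subtype.ext (funext h'))
  refine ⟨j, ⟨Function.update A.1 j (o.1 j), fun k => ?_⟩, fun k hk => ?_, ?_⟩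
  · by_cases hk : k = j
    · subst hk; simpa using o.2 k
    · simpa [hk] using A.2 k
  · simp [hk]
  · have : (Finset.univ.filter fun i => Function.update A.1 j (o.1 j) i ≠ o.1 i)
        = (Finset.univ.filter fun i => A.1 i ≠ o.1 i).erase j := by
      ext i
      by_cases hi : i = j
      · subst hi; simp
      · simp [hi]
    simp only [configDist]
    rw [this]
    exact Finset.card_erase_add_one (by simp [hj])

theorem configDist_le_of_agreeOff (o : Config M N K) {j : Fin N} {A B : Config M N K}
    (h : AgreeOff j B A) : configDist o B ≤ configDist o A + 1 := by
  unfold configDist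
  refine (Finset.card_le_card ?_).trans (Finset.card_insert_le j _)
  intro i hi
  by_cases hij : i = j
  · simp [hij]
  · have := h i hij
    simp_all

theorem configDist_le_or_gibbsKernel_eq_zero (E : Fin N → Config M N K → ℝ)
    (o A B : Config M N K) : configDist o B ≤ configDist o A + 1 ∨ gibbsKernel E A B = 0 := by
  by_cases h : ∃ j, AgreeOff j B A
  · obtain ⟨j, hj⟩ := h
    exact Or.inl (configDist_le_of_agreeOff o hj)
  · right
    push Not at h
    unfold gibbsKernel
    exact Finset.sum_eq_zero fun j _ => by rw [if_neg (h j), mul_zero]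

end GibbsKernel

/-! ### A Lyapunov function for the first visit to the target -/

/-- A function of the distance to the target which decreases at rate at least one, when the distance
increases by at most one in each step and decreases by one with probability at least `q`. -/
noncomputable def climbFunction (N : ℕ) (q : ℝ) (m : ℕ) : ℝ :=
  ∑ i ∈ Finset.range m, (2 / q) ^ (N - i)

theorem climbFunction_mono (N : ℕ) {q : ℝ} (hq : 0 < q) : Monotone (climbFunction N q) := by
  refine monotone_nat_of_le_succ fun m => ?_
  rw [climbFunction, climbFunction, Finset.sum_range_succ]
  have : 0 ≤ (2 / q) ^ (N - m) := by positivity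
  linarith

theorem climbFunction_le {N : ℕ} {q : ℝ} (hq : 0 < q) (hq1 : q ≤ 1) {m : ℕ} (hm : m ≤ N) :
    climbFunction N q m ≤ N * (2 / q) ^ N := by
  have h2 : 1 ≤ 2 / q := by rw [le_div_iff₀ hq]; linarith
  refine (climbFunction_mono N hq hm).trans ?_
  refine (Finset.sum_le_card_nsmul _ _ ((2 / q) ^ N) fun i _ => ?_).trans (by simp)
  exact pow_le_pow_right₀ h2 (Nat.sub_le _ _)

/-- Write c for the increment from m + 1 to m + 2; the one below is c * (2 / q). Even if every other
move goes up, the mean change is at most c - q * (c + 2 * c / q) ≤ -c ≤ -1. -/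
theorem climbFunction_drift {S : Type*} [Fintype S] {N : ℕ} {q : ℝ} (hq : 0 < q) (hq1 : q ≤ 1)
    (d : S → ℕ) (p : S → ℝ) (hp : ∀ y, 0 ≤ p y) (hp1 : ∑ y, p y = 1) {m : ℕ} (hmN : m + 1 ≤ N)
    (hup : ∀ y, d y ≤ m + 2 ∨ p y = 0) {y₀ : S} (hy₀ : d y₀ = m) (hq₀ : q ≤ p y₀) :
    ∑ y, p y * climbFunction N q (d y) ≤ climbFunction N q (m + 1) - 1 := by
  classical
  have hmono := climbFunction_mono N hq
  have h1 : ∑ y, p y * climbFunction N q (d y)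
      ≤ ∑ y, (p y * climbFunction N q (m + 2)
        - if y = y₀ then p y₀ * (climbFunction N q (m + 2) - climbFunction N q m) else 0) := by
    refine Finset.sum_le_sum fun y _ => ?_
    split_ifs with h
    · rw [h, hy₀]; apply le_of_eq; ring
    · rw [sub_zero]
      rcases hup y with h' | h'
      · exact mul_le_mul_of_nonneg_left (hmono h') (hp y)
      · simp [h']
  rw [Finset.sum_sub_distrib, ← Finset.sum_mul, hp1, one_mul, Finset.sum_ite_eq' ] at h1
  simp only [Finset.mem_univ, if_true] at h1
  have e1 : climbFunction N q (m + 2) = climbFunction N q (m + 1) + (2 / q) ^ (N - (m + 1)) := by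
    rw [climbFunction, Finset.sum_range_succ]; rfl
  have e2 : climbFunction N q (m + 1) = climbFunction N q m + (2 / q) ^ (N - m) := by
    rw [climbFunction, Finset.sum_range_succ]; rfl
  have e3 : N - m = (N - (m + 1)) + 1 := by omega
  set c := (2 / q) ^ (N - (m + 1)) with hc
  have hc1 : 1 ≤ c := one_le_pow₀ (by rw [le_div_iff₀ hq]; linarith)
  have e4 : (2 / q) ^ (N - m) = c * (2 / q) := by rw [e3, pow_succ]
  have h3 : climbFunction N q (m + 2) - climbFunction N q m = c + c * (2 / q) := by
    rw [e1, e2, e4]; ring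
  have h4 : q * (c + c * (2 / q)) ≤ p y₀ * (c + c * (2 / q)) :=
    mul_le_mul_of_nonneg_right hq₀ (by positivity)
  have h5 : q * (c + c * (2 / q)) = q * c + 2 * c := by field_simp
  have h6 : 0 ≤ q * c := by positivity
  rw [h3] at h1
  linarith

/-! ### Avoiding a target: drift bounds and the last exit decomposition -/

section Survival

theorem measurableSet_comp_of_fiber {Ω S : Type*} [Finite S] {m : MeasurableSpace Ω} {X : Ω → S}
    (hX : ∀ A, MeasurableSet[m] {ω | X ω = A}) (Q : S → Prop) :
    MeasurableSet[m] {ω | Q (X ω)} := by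
  have : {ω | Q (X ω)} = ⋃ A ∈ {A | Q A}, {ω | X ω = A} := by ext; simp
  rw [this]
  exact MeasurableSet.biUnion (Set.toFinite _).countable fun A _ => hX A

theorem measurable_comp_of_fiber {Ω S : Type*} [Finite S] {m : MeasurableSpace Ω} {X : Ω → S}
    (hX : ∀ A, MeasurableSet[m] {ω | X ω = A}) (w : S → ℝ) :
    Measurable[m] fun ω => w (X ω) :=
  fun s _ => measurableSet_comp_of_fiber hX fun A => w A ∈ s

theorem integrable_comp_of_fiber {Ω S : Type*} [Finite S] {mΩ : MeasurableSpace Ω} {μ : Measure Ω}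
    [IsFiniteMeasure μ] {X : Ω → S}
    (hX : ∀ A, MeasurableSet {ω | X ω = A}) (w : S → ℝ) :
    Integrable (fun ω => w (X ω)) μ := by
  cases nonempty_fintype S
  refine Integrable.of_bound (measurable_comp_of_fiber hX w).aestronglyMeasurable
    (∑ A, ‖w A‖) (ae_of_all _ fun ω => ?_)
  exact Finset.single_le_sum (f := fun A => ‖w A‖) (fun _ _ => norm_nonneg _) (Finset.mem_univ _)

variable {Ω : Type*} {mΩ : MeasurableSpace Ω} {μ : Measure Ω} [IsProbabilityMeasure μ]
  {S : Type*} [Fintype S] {ℋ : Filtration ℕ mΩ} {V : ℕ → Ω → S} {p : ℕ → Ω → S → S → ℝ}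

/-- Decompose `w (V (t + 1))` along the finitely many states and replace each indicator by its
conditional probability, which is legitimate on F since F is known before the update. -/
theorem setIntegral_le_of_transition
    (hV : ∀ t A, MeasurableSet[ℋ (t + 1)] {ω | V t ω = A})
    (hp : ∀ t A, μ[Set.indicator {ω | V (t + 1) ω = A} (fun _ => (1 : ℝ)) | ℋ (t + 1)] =ᵐ[μ]
      fun ω => p t ω (V t ω) A)
    {t : ℕ} {F : Set Ω} (hF : MeasurableSet[ℋ (t + 1)] F) (w : S → ℝ) {g : Ω → ℝ}
    (hg : Integrable g μ) (h : ∀ ω ∈ F, ∑ A, p t ω (V t ω) A * w A ≤ g ω) :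
    ∫ ω in F, w (V (t + 1) ω) ∂μ ≤ ∫ ω in F, g ω ∂μ := by
  classical
  have hF' : MeasurableSet F := ℋ.le _ _ hF
  have hV' : ∀ t A, MeasurableSet {ω | V t ω = A} := fun t A => ℋ.le _ _ (hV t A)
  have hint : ∀ A, Integrable (fun ω => p t ω (V t ω) A) μ := fun A =>
    integrable_condExp.congr (hp t A)
  have hind : ∀ A, Integrable (Set.indicator {ω | V (t + 1) ω = A} (fun _ => (1 : ℝ))) μ :=
    fun A => (integrable_const 1).indicator (hV' _ A)
  have e1 : ∀ ω, w (V (t + 1) ω)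
      = ∑ A, Set.indicator {ω | V (t + 1) ω = A} (fun _ => (1 : ℝ)) ω * w A := fun ω => by
    rw [Finset.sum_eq_single (V (t + 1) ω)]
    · simp
    · intro A _ hA
      simp [hA.symm]
    · simp
  have e2 : ∀ A, ∫ ω in F, Set.indicator {ω | V (t + 1) ω = A} (fun _ => (1 : ℝ)) ω ∂μ
      = ∫ ω in F, p t ω (V t ω) A ∂μ := fun A => by
    rw [← setIntegral_condExp (ℋ.le _) (hind A) hF]
    exact setIntegral_congr_ae hF' ((hp t A).mono fun ω h _ => h)
  calc ∫ ω in F, w (V (t + 1) ω) ∂μ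
      = ∑ A, ∫ ω in F, Set.indicator {ω | V (t + 1) ω = A} (fun _ => (1 : ℝ)) ω * w A ∂μ := by
        simp_rw [e1]
        exact integral_finsetSum _ fun A _ => ((hind A).mul_const _).integrableOn
    _ = ∑ A, ∫ ω in F, p t ω (V t ω) A * w A ∂μ := by
        refine Finset.sum_congr rfl fun A _ => ?_
        rw [integral_mul_const, integral_mul_const, e2]
    _ = ∫ ω in F, ∑ A, p t ω (V t ω) A * w A ∂μ :=
        (integral_finsetSum _ fun A _ => ((hint A).mul_const _).integrableOn).symm
    _ ≤ ∫ ω in F, g ω ∂μ :=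
        setIntegral_mono_on (integrable_finsetSum _ fun A _ => (hint A).mul_const _).integrableOn
          hg.integrableOn hF' h

/-- A Lyapunov bound for the probability that the target `o` is avoided. -/
theorem survival_bound
    (hV : ∀ t A, MeasurableSet[ℋ (t + 1)] {ω | V t ω = A})
    (hp : ∀ t A, μ[Set.indicator {ω | V (t + 1) ω = A} (fun _ => (1 : ℝ)) | ℋ (t + 1)] =ᵐ[μ]
      fun ω => p t ω (V t ω) A)
    {Gd : ℕ → Set Ω} (hGd : ∀ t, MeasurableSet[ℋ (t + 1)] (Gd t)) (o : S)
    {w : S → ℝ} (hw : ∀ A, 0 ≤ w A) (a J : ℕ)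
    (hdrift : ∀ j < J, ∀ ω ∈ Gd (a + j), V (a + j) ω ≠ o →
      ∑ A, p (a + j) ω (V (a + j) ω) A * w A ≤ w (V (a + j) ω) - 1)
    {F : Set Ω} (hF : MeasurableSet[ℋ (a + 1)] F) :
    J * μ.real (F ∩ {ω | ∀ j < J, V (a + j) ω ≠ o ∧ ω ∈ Gd (a + j)})
      ≤ ∫ ω in F, w (V a ω) ∂μ := by
  have hV' : ∀ t A, MeasurableSet {ω | V t ω = A} := fun t A => ℋ.le _ _ (hV t A)
  let F' : ℕ → Set Ω := fun m => F ∩ {ω | ∀ j < m, V (a + j) ω ≠ o ∧ ω ∈ Gd (a + j)}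
  have hF' : ∀ m, MeasurableSet[ℋ (a + m + 1)] (F' m) := by
    intro m
    refine MeasurableSet.inter (ℋ.mono (by omega) _ hF) ?_
    have : {ω | ∀ j < m, V (a + j) ω ≠ o ∧ ω ∈ Gd (a + j)}
        = ⋂ j ∈ Set.Iio m, ({ω | V (a + j) ω = o}ᶜ ∩ Gd (a + j)) := by
      ext; simp
    rw [this]
    refine MeasurableSet.biInter (Set.to_countable _) fun j hj => ?_
    have hj' : j < m := hj
    refine ℋ.mono (show a + j + 1 ≤ a + m + 1 by omega) _ ?_
    exact ((hV _ o).compl).inter (hGd _)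
  have hanti : Antitone F' := fun m n hmn ω hω => ⟨hω.1, fun j hj => hω.2 j (by omega)⟩
  have hF'' : ∀ m, MeasurableSet (F' m) := fun m => ℋ.le _ _ (hF' m)
  have hwint : ∀ t, Integrable (fun ω => w (V t ω)) μ := fun t => integrable_comp_of_fiber (hV' t) w
  -- A supermartingale argument: each surviving step lowers the integral of w by at least the
  -- measure of `F' (m + 1)`, hence by that of the smaller `F' J`.
  have step : ∀ m ≤ J, m * μ.real (F' J) + ∫ ω in F' m, w (V (a + m) ω) ∂μ
      ≤ ∫ ω in F, w (V a ω) ∂μ := by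
    intro m
    induction m with
    | zero => intro _; simp [F']
    | succ m ih =>
      intro hm
      have hF1 : MeasurableSet[ℋ (a + m + 1)] (F' (m + 1)) := by
        have : F' (m + 1) = F' m ∩ ({ω | V (a + m) ω = o}ᶜ ∩ Gd (a + m)) := by
          ext ω
          simp only [F', Set.mem_inter_iff, Set.mem_ofPred_eq, Nat.lt_succ_iff_lt_or_eq,
            Set.mem_compl_iff]
          constructor
          · rintro ⟨h1, h2⟩
            exact ⟨⟨h1, fun j hj => h2 j (Or.inl hj)⟩, h2 m (Or.inr rfl)⟩
          · rintro ⟨⟨h1, h2⟩, h3⟩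
            refine ⟨h1, fun j hj => ?_⟩
            rcases hj with hj | rfl
            · exact h2 j hj
            · exact h3
        rw [this]
        exact (hF' m).inter (((hV _ o).compl).inter (hGd _))
      have h1 : ∫ ω in F' (m + 1), w (V (a + m + 1) ω) ∂μ
          ≤ ∫ ω in F' (m + 1), (w (V (a + m) ω) - 1) ∂μ :=
        setIntegral_le_of_transition hV hp hF1 w ((hwint _).sub (integrable_const 1))
          fun ω hω => hdrift m hm ω (hω.2 m (Nat.lt_succ_self m)).2 (hω.2 m (Nat.lt_succ_self m)).1
      rw [integral_sub (hwint _).integrableOn (integrable_const 1).integrableOn] at h1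
      have h2 : ∫ ω in F' (m + 1), w (V (a + m) ω) ∂μ ≤ ∫ ω in F' m, w (V (a + m) ω) ∂μ :=
        setIntegral_mono_set (hwint _).integrableOn (ae_of_all _ fun ω => hw _)
          (hanti (Nat.le_succ m)).eventuallyLE
      have h3 : ∫ _ in F' (m + 1), (1 : ℝ) ∂μ = μ.real (F' (m + 1)) := by simp
      have h4 : μ.real (F' J) ≤ μ.real (F' (m + 1)) := measureReal_mono (hanti hm)
      have := ih (by omega)
      push_cast
      rw [← add_assoc]
      linarith
  have := step J le_rfl
  have h0 : 0 ≤ ∫ ω in F' J, w (V (a + J) ω) ∂μ := integral_nonneg fun _ => hw _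
  linarith

/-- The last exit decomposition: the probability of being away from the target `o` at time `n`, in
terms of a Lyapunov function `f` for the first visit of `o` and one, `w`, for the returns to `o`. -/
theorem measureReal_ne_le
    (hV : ∀ t A, MeasurableSet[ℋ (t + 1)] {ω | V t ω = A})
    (hp : ∀ t A, μ[Set.indicator {ω | V (t + 1) ω = A} (fun _ => (1 : ℝ)) | ℋ (t + 1)] =ᵐ[μ]
      fun ω => p t ω (V t ω) A)
    {Gd : ℕ → Set Ω} (hGd : ∀ t, MeasurableSet[ℋ (t + 1)] (Gd t)) (o : S)
    {f w : S → ℝ} (hf : ∀ A, 0 ≤ f A) (hw : ∀ A, 0 ≤ w A) {c κ : ℝ} (hfc : ∀ A, f A ≤ c)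
    (hκ : 0 ≤ κ) {m n : ℕ} (hmn : m ≤ n)
    (hfdrift : ∀ t, m ≤ t → t ≤ n → ∀ ω ∈ Gd t, V t ω ≠ o →
      ∑ A, p t ω (V t ω) A * f A ≤ f (V t ω) - 1)
    (hwdrift : ∀ t, m ≤ t → t ≤ n → ∀ ω ∈ Gd t, V t ω ≠ o →
      ∑ A, p t ω (V t ω) A * w A ≤ w (V t ω) - 1)
    (hexit : ∀ t, m ≤ t → t ≤ n → ∀ ω ∈ Gd t, V t ω = o → ∑ A, p t ω (V t ω) A * w A ≤ κ) :
    μ.real ({ω | V n ω ≠ o} ∩ {ω | ∀ t, m ≤ t → t ≤ n → ω ∈ Gd t})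
      ≤ c / ((n - m : ℕ) + 1) + κ * (harmonic n : ℝ) := by
  have hV' : ∀ t A, MeasurableSet {ω | V t ω = A} := fun t A => ℋ.le _ _ (hV t A)
  -- `A₀`: no visit to o in the window. `A₁ l`: the last visit is at n - l, so the excursion from o
  -- is away at the l slots n - l + 1, ..., n.
  let A₀ : Set Ω := Set.univ ∩ {ω | ∀ j < n - m + 1, V (m + j) ω ≠ o ∧ ω ∈ Gd (m + j)}
  let A₁ : ℕ → Set Ω := fun l => ({ω | V (n - l) ω = o} ∩ Gd (n - l)) ∩
    {ω | ∀ j < l, V (n - l + 1 + j) ω ≠ o ∧ ω ∈ Gd (n - l + 1 + j)}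
  have hsub : {ω | V n ω ≠ o} ∩ {ω | ∀ t, m ≤ t → t ≤ n → ω ∈ Gd t}
      ⊆ A₀ ∪ ⋃ l ∈ Finset.Icc 1 (n - m), A₁ l := by
    classical
    rintro ω ⟨hne, hgood⟩
    by_cases hex : ∃ l, l ≤ n - m ∧ V (n - l) ω = o
    · right
      obtain ⟨hl1, hl2⟩ := Nat.find_spec hex
      set l := Nat.find hex
      have hl0 : l ≠ 0 := fun h => hne (by rw [h] at hl2; exact hl2)
      simp only [Set.mem_iUnion]
      refine ⟨l, Finset.mem_Icc.mpr ⟨by omega, hl1⟩, ⟨hl2, hgood _ (by omega) (by omega)⟩, ?_⟩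
      intro j hj
      refine ⟨fun h => ?_, hgood _ (by omega) (by omega)⟩
      refine Nat.find_min hex (m := l - 1 - j) (by omega) ⟨by omega, ?_⟩
      rwa [show n - (l - 1 - j) = n - l + 1 + j by omega]
    · left
      refine ⟨trivial, fun j hj => ⟨fun h => hex ⟨n - m - j, by omega, ?_⟩,
        hgood _ (by omega) (by omega)⟩⟩
      rwa [show n - (n - m - j) = m + j by omega]
  have h0 : μ.real A₀ ≤ c / ((n - m : ℕ) + 1) := by
    have := survival_bound (μ := μ) hV hp hGd o hf m (n - m + 1)
      (fun j hj => hfdrift (m + j) (by omega) (by omega)) (F := Set.univ) MeasurableSet.univ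
    rw [le_div_iff₀ (by positivity), mul_comm]
    have h2 : ∫ ω in Set.univ, f (V m ω) ∂μ ≤ c := by
      rw [setIntegral_univ]
      calc ∫ ω, f (V m ω) ∂μ ≤ ∫ _, c ∂μ :=
            integral_mono (integrable_comp_of_fiber (hV' m) f) (integrable_const c) fun ω => hfc _
        _ = c := by simp
    push_cast at this
    exact this.trans h2
  have h1 : ∀ l ∈ Finset.Icc 1 (n - m), μ.real (A₁ l) ≤ κ * (l : ℝ)⁻¹ := by
    intro l hl
    rw [Finset.mem_Icc] at hl
    have hFm : MeasurableSet[ℋ (n - l + 1)] ({ω | V (n - l) ω = o} ∩ Gd (n - l)) :=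
      (hV _ o).inter (hGd _)
    have := survival_bound (μ := μ) hV hp hGd o hw (n - l + 1) l
      (fun j hj => hwdrift (n - l + 1 + j) (by omega) (by omega))
      (F := {ω | V (n - l) ω = o} ∩ Gd (n - l)) (ℋ.mono (by omega) _ hFm)
    -- The survival bound starts one slot after the visit, so its initial mean of w is the exit cost
    -- at o.
    have h3 : ∫ ω in {ω | V (n - l) ω = o} ∩ Gd (n - l), w (V (n - l + 1) ω) ∂μ
        ≤ ∫ _ in {ω | V (n - l) ω = o} ∩ Gd (n - l), κ ∂μ :=
      setIntegral_le_of_transition hV hp hFm w (integrable_const κ)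
        fun ω hω => hexit (n - l) (by omega) (by omega) ω hω.2 hω.1
    have h4 : ∫ _ in {ω | V (n - l) ω = o} ∩ Gd (n - l), κ ∂μ ≤ κ := by
      simp only [integral_const, MeasurableSet.univ, measureReal_restrict_apply, Set.univ_inter,
        smul_eq_mul]
      exact mul_le_of_le_one_left hκ measureReal_le_one
    have hl0 : (0 : ℝ) < l := by exact_mod_cast hl.1
    rw [← div_eq_mul_inv, le_div_iff₀ hl0, mul_comm]
    exact this.trans (h3.trans h4)
  calc μ.real ({ω | V n ω ≠ o} ∩ {ω | ∀ t, m ≤ t → t ≤ n → ω ∈ Gd t})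
      ≤ μ.real (A₀ ∪ ⋃ l ∈ Finset.Icc 1 (n - m), A₁ l) := measureReal_mono hsub
    _ ≤ μ.real A₀ + μ.real (⋃ l ∈ Finset.Icc 1 (n - m), A₁ l) := measureReal_union_le _ _
    _ ≤ c / ((n - m : ℕ) + 1) + ∑ l ∈ Finset.Icc 1 (n - m), κ * (l : ℝ)⁻¹ :=
        add_le_add h0 ((measureReal_biUnion_finset_le _ _).trans (Finset.sum_le_sum h1))
    _ ≤ c / ((n - m : ℕ) + 1) + κ * (harmonic n : ℝ) := by
        rw [← Finset.mul_sum, harmonic_eq_sum_Icc]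
        push_cast
        gcongr
        · exact Nat.sub_le _ _

end Survival

/-! ### Lyapunov functions for the disturbed Gibbs sampler at a frozen temperature -/

section Drift

variable {M N K : ℕ}

/-- Lyapunov functions for all the Gibbs samplers whose exponents are within `η * β` of `β * H`,
where `H` has the same local differences as the potential `h` with the maximizer `o`. -/
theorem exists_gibbs_lyapunov (hN : 0 < N) (o : Config M N K) : ∃ m : ℕ,
    ∀ (h : Config M N K → ℝ) (H : Fin N → Config M N K → ℝ),
    (∀ j A B, AgreeOff j A B → H j A - h A = H j B - h B) →
    ∀ gap Δ : ℝ, (∀ A, A ≠ o → h A + gap ≤ h o) → (∀ A B, h A - h B ≤ Δ) →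
    ∀ β η : ℝ, 0 ≤ β → 0 ≤ η →
    ∃ f w : Config M N K → ℝ, (∀ A, 0 ≤ f A) ∧ (∀ A, 0 ≤ w A) ∧
      (∀ A, f A ≤ N * (2 * (N * Fintype.card (Config M N K)) * Real.exp (β * (Δ + 2 * η))) ^ N) ∧
      ∀ E : Fin N → Config M N K → ℝ, (∀ j A, |E j A - β * H j A| ≤ η * β) →
        (∀ B, B ≠ o → ∑ A, gibbsKernel E B A * f A ≤ f B - 1) ∧
        (∀ B, B ≠ o → ∑ A, gibbsKernel E B A * w A ≤ w B - 1) ∧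
        ∑ A, gibbsKernel E o A * w A
          ≤ Fintype.card (Config M N K) * Real.exp (β * (2 * η * (m + 1) - gap)) := by
  classical
  obtain ⟨m, hm⟩ := exists_robust_lyapunov o (Finset.univ.erase o) (Finset.notMem_erase o _)
  refine ⟨m, fun h H hH gap Δ hgap hΔ β η hβ hη => ?_⟩
  have hΔ0 : 0 ≤ Δ := by simpa using hΔ o o
  set n : ℝ := (Fintype.card (Config M N K) : ℝ) with hn
  have hn1 : 1 ≤ n := by
    rw [hn]; exact_mod_cast Fintype.card_pos_iff.mpr ⟨o⟩
  have hN1 : (1 : ℝ) ≤ N := by exact_mod_cast hN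
  let F : Config M N K → ℝ := fun A => β * h A
  have hF : ∀ A B, F A - F B ≤ β * Δ := fun A B => by
    simp only [F]; rw [← mul_sub]; exact mul_le_mul_of_nonneg_left (hΔ A B) hβ
  set D : ℝ := Real.exp (2 * (η * β)) with hD
  have hD1 : 1 ≤ D := Real.one_le_exp (by positivity)
  have hD0 : 0 < D := Real.exp_pos _
  set k : Config M N K → Config M N K → ℝ := gibbsKernel (fun _ => F) with hk
  have hkE : ∀ E : Fin N → Config M N K → ℝ, (∀ j A, |E j A - β * H j A| ≤ η * β) →
      ∀ B A, k B A / D ≤ gibbsKernel E B A ∧ gibbsKernel E B A ≤ D * k B A := by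
    intro E hE B A
    have e : ∀ B A, gibbsKernel (fun j A => β * H j A) B A = k B A := fun B A =>
      gibbsKernel_congr (fun j A B hAB => by
        simp only [F]
        rw [← mul_sub, ← mul_sub, hH j A B hAB]) B A
    constructor
    · rw [div_le_iff₀' hD0, ← e]
      exact gibbsKernel_le_of_abs_sub_le (fun j A => by rw [abs_sub_comm]; exact hE j A) B A
    · rw [← e]
      exact gibbsKernel_le_of_abs_sub_le hE B A
  -- With unit cost the bound at o becomes D ^ m times the Gibbs mass off o, relative to that of o;
  -- the gap makes this exponentially small in β.
  obtain ⟨w, hwo, hw0, hwd, hwe⟩ := hm D k (fun A => Real.exp (F A)) (fun _ => 1) (configDist o)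
    hD1 (gibbsKernel_nonneg _) (fun _ => (Real.exp_pos _).le) (fun _ => zero_le_one)
    (gibbsKernel_reversible F) (fun A hA => by
      obtain ⟨j, B, hBA, hd⟩ := exists_agreeOff_configDist_lt (Finset.ne_of_mem_erase hA)
      refine ⟨B, by by_cases hB : B = o <;> simp [hB], by omega, ?_⟩
      exact lt_of_lt_of_le (by positivity) (le_gibbsKernel hF hBA))
  have hins : insert o (Finset.univ.erase o) = Finset.univ := Finset.insert_erase (Finset.mem_univ o)
  rw [hins] at hwd
  -- A lower bound for the probability of correcting a given column: the frozen kernel gives exp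
  -- (-(β * Δ)), and the perturbation costs D = exp (2 * η * β).
  set q : ℝ := 1 / (N * n) * Real.exp (-(β * (Δ + 2 * η))) with hq
  have hq0 : 0 < q := by positivity
  have hq1 : q ≤ 1 := by
    have h1 : 1 / (N * n) ≤ 1 := by
      rw [div_le_one (by positivity)]
      exact one_le_mul_of_one_le_of_one_le hN1 hn1
    have h2 : Real.exp (-(β * (Δ + 2 * η))) ≤ 1 := by
      rw [Real.exp_le_one_iff, neg_nonpos]; positivity
    exact mul_le_one₀ h1 (Real.exp_pos _).le h2
  have h2q : 2 / q = 2 * (N * n) * Real.exp (β * (Δ + 2 * η)) := by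
    rw [hq, Real.exp_neg]; field_simp
  refine ⟨fun A => climbFunction N q (configDist o A), w, fun A => ?_, hw0, fun A => ?_,
    fun E hE => ⟨fun B hB => ?_, fun B hB => ?_, ?_⟩⟩
  · exact (climbFunction_mono N hq0 (Nat.zero_le _)).trans' (by simp [climbFunction])
  · rw [← h2q]
    exact climbFunction_le hq0 hq1 (configDist_le o A)
  · obtain ⟨j, A₀, hA₀, hd⟩ := exists_agreeOff_configDist_lt hB
    beta_reduce
    rw [← hd]
    refine climbFunction_drift hq0 hq1 (configDist o) (gibbsKernel E B) (gibbsKernel_nonneg E B)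
      (sum_gibbsKernel hN E B) (hd ▸ configDist_le o B) (fun A => ?_) rfl (y₀ := A₀) ?_
    · have := configDist_le_or_gibbsKernel_eq_zero E o B A
      rwa [← hd] at this
    · refine le_trans ?_ (hkE E hE B A₀).1
      rw [le_div_iff₀ hD0]
      refine le_trans (le_of_eq ?_) (le_gibbsKernel hF hA₀)
      rw [hq, hD, mul_assoc, ← Real.exp_add]
      congr 2
      ring
  · have := hwd B (by simp [hB]) (gibbsKernel E B) (hkE E hE B)
    have e : ∑ y, gibbsKernel E B y * (w B - w y)
        = (∑ y, gibbsKernel E B y) * w B - ∑ y, gibbsKernel E B y * w y := by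
      rw [Finset.sum_mul, ← Finset.sum_sub_distrib]
      exact Finset.sum_congr rfl fun y _ => by ring
    rw [e, sum_gibbsKernel hN] at this
    linarith
  · have e1 : ∑ A, k o A * w A = ∑ A ∈ Finset.univ.erase o, k o A * w A := by
      rw [← Finset.add_sum_erase _ _ (Finset.mem_univ o), hwo]; simp
    have e2 : ∑ A, gibbsKernel E o A * w A ≤ D * ∑ A, k o A * w A := by
      rw [Finset.mul_sum]
      refine Finset.sum_le_sum fun A _ => ?_
      rw [← mul_assoc]
      exact mul_le_mul_of_nonneg_right (hkE E hE o A).2 (hw0 A)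
    have e3 : ∑ x ∈ Finset.univ.erase o, Real.exp (F x) * 1 ≤ n * Real.exp (F o - β * gap) := by
      refine (Finset.sum_le_card_nsmul _ _ (Real.exp (F o - β * gap)) fun x hx => ?_).trans ?_
      · rw [mul_one]
        refine Real.exp_le_exp.mpr ?_
        have := mul_le_mul_of_nonneg_left (hgap x (Finset.ne_of_mem_erase hx)) hβ
        simp only [F]
        linarith
      · rw [nsmul_eq_mul]
        refine mul_le_mul_of_nonneg_right ?_ (Real.exp_pos _).le
        rw [hn]
        exact_mod_cast (Finset.card_le_univ _)
    have e4 : Real.exp (F o) * ∑ A, k o A * w A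
        ≤ Real.exp (F o) * (D ^ m * (n * Real.exp (-(β * gap)))) := by
      rw [e1]
      refine hwe.trans ((mul_le_mul_of_nonneg_left e3 (by positivity)).trans (le_of_eq ?_))
      rw [sub_eq_add_neg, Real.exp_add]; ring
    have e5 := le_of_mul_le_mul_left e4 (Real.exp_pos _)
    calc ∑ A, gibbsKernel E o A * w A ≤ D * ∑ A, k o A * w A := e2
      _ ≤ D * (D ^ m * (n * Real.exp (-(β * gap)))) := by gcongr
      _ = n * (D ^ (m + 1) * Real.exp (-(β * gap))) := by ring
      _ = _ := by
        rw [hD, ← Real.exp_nat_mul, ← Real.exp_add]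
        congr 2
        push_cast
        ring

end Drift

/-! ### Convergence of the virtual caches -/

section Convergence

variable {M N K : ℕ}

/-- The sum of the local hit rates which governs the update of station `j`. -/
noncomputable def stationEnergy (cell : Fin N → Set Plane) (θ : Fin M → Finset (Fin N) → ℝ)
    (j : Fin N) (A : Config M N K) : ℝ :=
  ∑ n ∈ neighbours cell j, ∑ s with j ∈ s, localHitRate θ A n s

/-- The factor counts stations, sets of stations and contents; the denominators in the local hit
rates are at least one, so they do not enlarge errors. -/
theorem abs_stationEnergy_sub_le (cell : Fin N → Set Plane)
    {θ θ' : Fin M → Finset (Fin N) → ℝ} {ε : ℝ} (h : ∀ i s, |θ i s - θ' i s| ≤ ε)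
    (hε : 0 ≤ ε) (j : Fin N) (A : Config M N K) :
    |stationEnergy cell θ j A - stationEnergy cell θ' j A| ≤ (N * (2 ^ N * M) : ℕ) * ε := by
  have h1 : ∀ n s, |localHitRate θ A n s - localHitRate θ' A n s| ≤ M * ε := by
    intro n s
    unfold localHitRate
    rw [← Finset.sum_sub_distrib]
    refine (Finset.abs_sum_le_sum_abs _ _).trans
      ((Finset.sum_le_card_nsmul _ _ ε fun i _ => ?_).trans (by simp))
    split_ifs
    · rw [← sub_div, abs_div, Nat.abs_cast]
      exact (div_le_self (abs_nonneg _) (by exact_mod_cast le_max_left _ _)).trans (h i s)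
    · simpa using hε
  unfold stationEnergy
  rw [← Finset.sum_sub_distrib]
  have h2 : ∀ n, |∑ s with j ∈ s, localHitRate θ A n s - ∑ s with j ∈ s, localHitRate θ' A n s|
      ≤ 2 ^ N * (M * ε) := by
    intro n
    rw [← Finset.sum_sub_distrib]
    refine (Finset.abs_sum_le_sum_abs _ _).trans
      ((Finset.sum_le_card_nsmul _ _ (M * ε) fun s _ => h1 n s).trans ?_)
    rw [nsmul_eq_mul]
    refine mul_le_mul_of_nonneg_right ?_ (by positivity)
    have := Finset.card_le_univ (Finset.univ.filter fun s : Finset (Fin N) => j ∈ s)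
    rw [Fintype.card_finset, Fintype.card_fin] at this
    exact_mod_cast this
  refine (Finset.abs_sum_le_sum_abs _ _).trans
      ((Finset.sum_le_card_nsmul _ _ (2 ^ N * (M * ε)) fun n _ => h2 n).trans ?_)
  rw [nsmul_eq_mul]
  have := Finset.card_le_univ (neighbours cell j)
  rw [Fintype.card_fin] at this
  push_cast
  calc ((neighbours cell j).card : ℝ) * (2 ^ N * (M * ε)) ≤ N * (2 ^ N * (M * ε)) := by gcongr
    _ = _ := by ring

/-- Logarithmic cooling changes only by a bounded amount when time is multiplied by a constant,
which justifies freezing the temperature between n/2 and n. The additive 3 leaves room for the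
rounding. -/
theorem abs_inverseTemp_sub_le (hN : 0 < N) {β₀ : ℝ} (hβ₀ : 0 ≤ β₀) {s t : ℕ} (h : s ≤ 4 * t + 3)
    (h' : t ≤ 4 * s + 3) :
    |inverseTemp N β₀ s - inverseTemp N β₀ t| ≤ β₀ * Real.log 4 := by
  have key : ∀ {s t : ℕ}, s ≤ 4 * t + 3 → Real.log (1 + ((s / N : ℕ) : ℝ))
      ≤ Real.log 4 + Real.log (1 + ((t / N : ℕ) : ℝ)) := by
    intro s t h
    rw [← Real.log_mul (by norm_num) (by positivity)]
    refine Real.log_le_log (by positivity) ?_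
    have : s / N < 4 * (t / N + 1) := by
      rw [Nat.div_lt_iff_lt_mul hN]
      have := Nat.lt_mul_div_succ t hN
      nlinarith
    have h2 : s / N + 1 ≤ 4 * (t / N + 1) := this
    have : ((s / N : ℕ) : ℝ) + 1 ≤ 4 * (((t / N : ℕ) : ℝ) + 1) := by exact_mod_cast h2
    linarith
  unfold inverseTemp
  rw [← mul_sub, abs_mul, abs_of_nonneg hβ₀]
  refine mul_le_mul_of_nonneg_left (abs_le.mpr ⟨?_, ?_⟩) hβ₀
  · linarith [key h']
  · linarith [key h]

theorem tendsto_inverseTemp (hN : 0 < N) {β₀ : ℝ} (hβ₀ : 0 < β₀) :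
    Tendsto (inverseTemp N β₀) atTop atTop := by
  refine Tendsto.const_mul_atTop hβ₀ (Real.tendsto_log_atTop.comp ?_)
  exact tendsto_atTop_add_const_left _ _
    (tendsto_natCast_atTop_atTop.comp (Nat.tendsto_div_const_atTop hN.ne'))

/-- Under logarithmic cooling, Boltzmann factors are powers of time. -/
theorem exp_inverseTemp_mul (N : ℕ) (β₀ c : ℝ) (n : ℕ) :
    Real.exp (inverseTemp N β₀ n * c) = (1 + ((n / N : ℕ) : ℝ)) ^ (β₀ * c) := by
  rw [Real.rpow_def_of_pos (by positivity), inverseTemp]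
  congr 1
  ring

variable {Ω : Type*} {mΩ : MeasurableSpace Ω} {μ : Measure Ω} [IsProbabilityMeasure μ]

/-- Eventually almost sure events hold from `n / 2` on with probability tending to one. -/
theorem tendsto_measureReal_exists_notMem {Gd : ℕ → Set Ω} (hGd : ∀ t, MeasurableSet (Gd t))
    (h : ∀ᵐ ω ∂μ, ∀ᶠ t in atTop, ω ∈ Gd t) :
    Tendsto (fun n : ℕ => μ.real {ω | ∃ t, n / 2 ≤ t ∧ ω ∉ Gd t}) atTop (𝓝 0) := by
  have hanti : Antitone fun m : ℕ => {ω | ∃ t, m ≤ t ∧ ω ∉ Gd t} :=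
    fun m n hmn ω ⟨t, ht, hω⟩ => ⟨t, hmn.trans ht, hω⟩
  have hmeas : ∀ m : ℕ, MeasurableSet {ω | ∃ t, m ≤ t ∧ ω ∉ Gd t} := by
    intro m
    have : {ω | ∃ t, m ≤ t ∧ ω ∉ Gd t} = ⋃ t ∈ Set.Ici m, (Gd t)ᶜ := by ext; simp
    rw [this]
    exact MeasurableSet.biUnion (Set.to_countable _) fun t _ => (hGd t).compl
  have h1 := tendsto_measure_iInter_atTop (μ := μ) (fun m => (hmeas m).nullMeasurableSet) hanti
    ⟨0, measure_ne_top _ _⟩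
  have h0 : μ (⋂ m : ℕ, {ω | ∃ t, m ≤ t ∧ ω ∉ Gd t}) = 0 := by
    refine measure_mono_null ?_ (ae_iff.mp h)
    intro ω hω hev
    obtain ⟨m, hm⟩ := eventually_atTop.mp hev
    obtain ⟨t, ht, hω'⟩ := Set.mem_iInter.mp hω m
    exact hω' (hm t ht)
  rw [h0] at h1
  have h2 := (ENNReal.tendsto_toReal ENNReal.zero_ne_top).comp h1
  exact h2.comp (Nat.tendsto_div_const_atTop (by norm_num))

theorem tendsto_power_add_power_log {a b : ℝ} (ha : a < 1) (hb : 0 < b) (C C' : ℝ) :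
    Tendsto (fun n : ℕ => C * ((n : ℝ) + 1) ^ (a - 1)
      + C' * (((n : ℝ) + 1) ^ (-b) * (1 + Real.log ((n : ℝ) + 1)))) atTop (𝓝 0) := by
  have hx : Tendsto (fun n : ℕ => (n : ℝ) + 1) atTop atTop :=
    tendsto_atTop_add_const_right _ _ tendsto_natCast_atTop_atTop
  have h1 : Tendsto (fun x : ℝ => x ^ (a - 1)) atTop (𝓝 0) := by
    have := tendsto_rpow_neg_atTop (y := 1 - a) (by linarith)
    simpa using this
  have h2 : Tendsto (fun x : ℝ => x ^ (-b) * Real.log x) atTop (𝓝 0) := by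
    have := (isLittleO_log_rpow_atTop hb).tendsto_div_nhds_zero
    refine this.congr' ?_
    filter_upwards [eventually_gt_atTop 0] with x hx
    rw [Real.rpow_neg hx.le, div_eq_inv_mul]
  have h3 : Tendsto (fun x : ℝ => C * x ^ (a - 1) + C' * (x ^ (-b) * (1 + Real.log x))) atTop
      (𝓝 (C * 0 + C' * (0 + 0))) := by
    refine (h1.const_mul C).add (Tendsto.const_mul C' ?_)
    simp_rw [mul_add, mul_one]
    exact (tendsto_rpow_neg_atTop hb).add h2
  have h4 := h3.comp hx
  simp only [mul_zero, add_zero] at h4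
  exact h4

/-- The virtual caches converge in probability to the unique maximizer of the potential. -/
theorem tendsto_measureReal_virtual_ne (hN : 0 < N) (cell : Fin N → Set Plane)
    (θ' : Fin M → Finset (Fin N) → ℝ) (h : Config M N K → ℝ) (o : Config M N K)
    (hpot : ∀ j A B, AgreeOff j A B →
      stationEnergy cell θ' j A - h A = stationEnergy cell θ' j B - h B)
    (ho : ∀ A, A ≠ o → h A < h o) {Δ β₀ : ℝ} (hΔ : ∀ A B, h A - h B ≤ Δ) (hβ₀ : 0 < β₀)
    (hβΔ : β₀ * N * Δ < 1) {ℋ : Filtration ℕ mΩ}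
    {θ : Fin N → Fin M → Finset (Fin N) → ℕ → Ω → ℝ}
    (hθ : ∀ k i s, ∀ᵐ ω ∂μ, Tendsto (fun t => θ k i s t ω) atTop (𝓝 (θ' i s)))
    {V : ℕ → Ω → Config M N K} (hV : IsVirtualCacheProcess μ ℋ cell β₀ θ V) :
    Tendsto (fun n => μ.real {ω | V n ω ≠ o}) atTop (𝓝 0) := by
  classical
  have hΔ0 : 0 ≤ Δ := by simpa using hΔ o o
  have hN0 : (0 : ℝ) < N := by exact_mod_cast hN
  obtain ⟨gap, hgap0, hgap⟩ : ∃ gap : ℝ, 0 < gap ∧ ∀ A, A ≠ o → h A + gap ≤ h o := by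
    by_cases hne : (Finset.univ.erase o).Nonempty
    · obtain ⟨A₀, hA₀, hmin⟩ := Finset.exists_min_image _ (fun A => h o - h A) hne
      refine ⟨h o - h A₀, sub_pos.mpr (ho A₀ (Finset.ne_of_mem_erase hA₀)), fun A hA => ?_⟩
      have := hmin A (by simp [hA])
      linarith
    · refine ⟨1, one_pos, fun A hA => absurd ⟨A, by simp [hA]⟩ hne⟩
  obtain ⟨m, hm⟩ := exists_gibbs_lyapunov hN o
  set n₀ : ℝ := (Fintype.card (Config M N K) : ℝ) with hn₀
  -- The first bound keeps at least half of the gap in the exit cost; the second keeps the exponent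
  -- of the first visit below one.
  set η : ℝ := min (gap / (4 * (m + 1))) ((1 - β₀ * N * Δ) / (4 * (β₀ * N))) with hη
  have hη0 : 0 < η := lt_min (by positivity) (div_pos (by linarith) (by positivity))
  have hη1 : 2 * η * (m + 1) - gap ≤ - (gap / 2) := by
    have : η ≤ gap / (4 * (m + 1)) := min_le_left _ _
    rw [le_div_iff₀ (by positivity)] at this
    linarith
  have hη2 : β₀ * (N * (Δ + 2 * η)) < 1 := by
    have : η ≤ (1 - β₀ * N * Δ) / (4 * (β₀ * N)) := min_le_right _ _
    rw [le_div_iff₀ (by positivity)] at this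
    nlinarith
  set C₁ : ℝ := ((N * (2 ^ N * M) : ℕ) : ℝ) with hC₁
  have hC₁0 : 0 ≤ C₁ := Nat.cast_nonneg _
  set ε : ℝ := η / (2 * (C₁ + 1)) with hε
  have hε0 : 0 < ε := by positivity
  have hC₁ε : C₁ * ε ≤ η / 2 := by
    have : (C₁ + 1) * ε = η / 2 := by rw [hε]; field_simp
    linarith
  obtain ⟨C₂, hC₂⟩ : ∃ C₂ : ℝ, ∀ (j : Fin N) (A : Config M N K),
      |stationEnergy cell θ' j A| ≤ C₂ := by
    refine ⟨∑ j, ∑ A : Config M N K, |stationEnergy cell θ' j A|, fun j A => ?_⟩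
    refine (Finset.single_le_sum (f := fun A : Config M N K => |stationEnergy cell θ' j A|)
      (fun _ _ => abs_nonneg _) (Finset.mem_univ A)).trans ?_
    exact Finset.single_le_sum (f := fun j => ∑ A : Config M N K, |stationEnergy cell θ' j A|)
      (fun _ _ => Finset.sum_nonneg fun _ _ => abs_nonneg _) (Finset.mem_univ j)
  -- The index is shifted because the move from `V t` to `V (t + 1)` uses the estimates of slot t +
  -- 1, which are known in `ℋ (t + 1)`.
  let Gd : ℕ → Set Ω := fun t => {ω | ∀ k i s, |θ k i s (t + 1) ω - θ' i s| ≤ ε}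
  have hGd : ∀ t, MeasurableSet[ℋ (t + 1)] (Gd t) := by
    intro t
    have : Gd t = ⋂ k, ⋂ i, ⋂ s, (θ k i s (t + 1)) ⁻¹' (Metric.closedBall (θ' i s) ε) := by
      ext ω; simp [Gd, Real.dist_eq]
    rw [this]
    exact MeasurableSet.iInter fun k => MeasurableSet.iInter fun i => MeasurableSet.iInter fun s =>
      hV.measurable_estimate k i s (t + 1) measurableSet_closedBall
  have hGdae : ∀ᵐ ω ∂μ, ∀ᶠ t in atTop, ω ∈ Gd t := by
    have : ∀ᵐ ω ∂μ, ∀ k i s, Tendsto (fun t => θ k i s t ω) atTop (𝓝 (θ' i s)) := by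
      simp_rw [ae_all_iff]; exact hθ
    filter_upwards [this] with ω hω
    simp only [Gd, Set.mem_ofPred_eq, eventually_all]
    intro k i s
    have := ((hω k i s).comp (tendsto_add_atTop_nat 1)).eventually
      (Metric.closedBall_mem_nhds (θ' i s) hε0)
    exact this.mono fun t ht => by simpa [Real.dist_eq] using ht
  set β : ℕ → ℝ := inverseTemp N β₀ with hβ
  have hβ0 : ∀ n, 0 ≤ β n := fun n =>
    mul_nonneg hβ₀.le (Real.log_nonneg (by simp))
  have hlog4 : 0 ≤ β₀ * Real.log 4 := mul_nonneg hβ₀.le (Real.log_nonneg (by norm_num))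
  -- The total temperature drift over the window is bounded while β n diverges, so one half of η * β
  -- n absorbs it; the other half is for the estimates.
  have hlarge : ∀ᶠ n in atTop, (β₀ * Real.log 4) * (η / 2 + C₂) ≤ η / 2 * β n :=
    ((tendsto_inverseTemp hN hβ₀).const_mul_atTop (half_pos hη0)).eventually_ge_atTop _
  have hbound : ∀ᶠ n in atTop, μ.real {ω | V n ω ≠ o} ≤
      (2 * (N * (2 * (N * n₀)) ^ N) * ((n : ℝ) + 1) ^ (β₀ * (N * (Δ + 2 * η)) - 1)
      + n₀ * (N : ℝ) ^ (β₀ * (gap / 2)) * (((n : ℝ) + 1) ^ (-(β₀ * (gap / 2)))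
        * (1 + Real.log ((n : ℝ) + 1))))
      + μ.real {ω | ∃ t, n / 2 ≤ t ∧ ω ∉ Gd t} := by
    filter_upwards [hlarge] with n hn
    obtain ⟨f, w, hf0, hw0, hfc, hfw⟩ := hm h (stationEnergy cell θ') hpot gap Δ hgap hΔ (β n) η
      (hβ0 n) hη0.le
    have hE : ∀ t, n / 2 ≤ t → t ≤ n → ∀ ω ∈ Gd t, ∀ (j : Fin N) (A : Config M N K),
        |inverseTemp N β₀ (t + 1) * stationEnergy cell (fun i s => θ j i s (t + 1) ω) j A
          - β n * stationEnergy cell θ' j A| ≤ η * β n := by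
      intro t ht1 ht2 ω hω j A
      have b1 := abs_stationEnergy_sub_le cell (fun i s => hω j i s) hε0.le j A
      have b2 := abs_inverseTemp_sub_le hN hβ₀.le (s := t + 1) (t := n) (by omega) (by omega)
      have b3 : β (t + 1) ≤ β n + β₀ * Real.log 4 := by linarith [(abs_le.mp b2).2]
      have b0 := hβ0 (t + 1)
      calc |β (t + 1) * stationEnergy cell (fun i s => θ j i s (t + 1) ω) j A
          - β n * stationEnergy cell θ' j A|
          = |β (t + 1) * (stationEnergy cell (fun i s => θ j i s (t + 1) ω) j A
              - stationEnergy cell θ' j A)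
            + (β (t + 1) - β n) * stationEnergy cell θ' j A| := by congr 1; ring
        _ ≤ β (t + 1) * |stationEnergy cell (fun i s => θ j i s (t + 1) ω) j A
              - stationEnergy cell θ' j A|
            + |β (t + 1) - β n| * |stationEnergy cell θ' j A| := by
          refine (abs_add_le _ _).trans ?_
          rw [abs_mul, abs_mul, abs_of_nonneg b0]
        _ ≤ (β n + β₀ * Real.log 4) * (η / 2) + (β₀ * Real.log 4) * C₂ := by
          refine add_le_add (mul_le_mul b3 (b1.trans hC₁ε) (abs_nonneg _) ?_)
            (mul_le_mul b2 (hC₂ j A) (abs_nonneg _) hlog4)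
          exact b0.trans b3
        _ ≤ η * β n := by linarith
    have hmain := measureReal_ne_le (μ := μ)
      (p := fun t ω B A => updateProb cell (inverseTemp N β₀ (t + 1))
        (fun k i s => θ k i s (t + 1) ω) B A)
      hV.measurable_config hV.update hGd o hf0 hw0 hfc (κ := n₀ * Real.exp (β n * (2 * η * (m + 1) - gap)))
      (by positivity) (Nat.div_le_self n 2)
      (fun t h1 h2 ω hω hne => (hfw _ (hE t h1 h2 ω hω)).1 _ hne)
      (fun t h1 h2 ω hω hne => (hfw _ (hE t h1 h2 ω hω)).2.1 _ hne)
      (fun t h1 h2 ω hω he => by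
        rw [he]; exact (hfw _ (hE t h1 h2 ω hω)).2.2)
    have hsplit : μ.real {ω | V n ω ≠ o}
        ≤ μ.real ({ω | V n ω ≠ o} ∩ {ω | ∀ t, n / 2 ≤ t → t ≤ n → ω ∈ Gd t})
          + μ.real {ω | ∃ t, n / 2 ≤ t ∧ ω ∉ Gd t} := by
      refine (measureReal_mono ?_).trans (measureReal_union_le _ _)
      intro ω hω
      by_cases hg : ∀ t, n / 2 ≤ t → t ≤ n → ω ∈ Gd t
      · exact Or.inl ⟨hω, hg⟩
      · push Not at hg
        obtain ⟨t, h1, _, h3⟩ := hg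
        exact Or.inr ⟨t, h1, h3⟩
    refine hsplit.trans (add_le_add (hmain.trans (add_le_add ?_ ?_)) le_rfl)
    · have hx : (0 : ℝ) < (n : ℝ) + 1 := by positivity
      have e1 : (2 * (N * n₀) * Real.exp (β n * (Δ + 2 * η))) ^ N
          ≤ (2 * (N * n₀)) ^ N * ((n : ℝ) + 1) ^ (β₀ * (N * (Δ + 2 * η))) := by
        have e0 : (N : ℝ) * (β n * (Δ + 2 * η)) = β n * (N * (Δ + 2 * η)) := by ring
        rw [mul_pow, ← Real.exp_nat_mul, e0, hβ, exp_inverseTemp_mul]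
        refine mul_le_mul_of_nonneg_left ?_ (by positivity)
        refine Real.rpow_le_rpow (by positivity) ?_ (by positivity)
        have : ((n / N : ℕ) : ℝ) ≤ n := by exact_mod_cast Nat.div_le_self n N
        linarith
      have e2 : ((n : ℝ) + 1) / 2 ≤ ((n - n / 2 : ℕ) : ℝ) + 1 := by
        have : n + 1 ≤ 2 * ((n - n / 2) + 1) := by omega
        have : ((n + 1 : ℕ) : ℝ) ≤ ((2 * ((n - n / 2) + 1) : ℕ) : ℝ) := by exact_mod_cast this
        push_cast at this
        linarith
      rw [div_le_iff₀ (by positivity), Real.rpow_sub_one hx.ne']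
      calc N * (2 * (N * n₀) * Real.exp (β n * (Δ + 2 * η))) ^ N
          ≤ N * ((2 * (N * n₀)) ^ N * ((n : ℝ) + 1) ^ (β₀ * (N * (Δ + 2 * η)))) := by gcongr
        _ = 2 * (N * (2 * (N * n₀)) ^ N) * (((n : ℝ) + 1) ^ (β₀ * (N * (Δ + 2 * η))) / (n + 1))
            * (((n : ℝ) + 1) / 2) := by field_simp
        _ ≤ _ := by gcongr
    · have hx : (0 : ℝ) < (n : ℝ) + 1 := by positivity
      have e1 : Real.exp (β n * (2 * η * (m + 1) - gap))
          ≤ (N : ℝ) ^ (β₀ * (gap / 2)) * ((n : ℝ) + 1) ^ (-(β₀ * (gap / 2))) := by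
        have : Real.exp (β n * (2 * η * (m + 1) - gap)) ≤ Real.exp (β n * (-(gap / 2))) :=
          Real.exp_le_exp.mpr (mul_le_mul_of_nonneg_left hη1 (hβ0 n))
        refine this.trans ?_
        have e0 : ((n : ℝ) + 1) / N ≤ 1 + ((n / N : ℕ) : ℝ) := by
          rw [div_le_iff₀ hN0]
          have : n + 1 ≤ (1 + n / N) * N := by
            have := Nat.lt_mul_div_succ n hN
            nlinarith
          exact_mod_cast this
        rw [hβ, exp_inverseTemp_mul, mul_neg, Real.rpow_neg (by positivity), Real.rpow_neg hx.le,
          ← div_eq_mul_inv, ← inv_div (((n : ℝ) + 1) ^ _) ((N : ℝ) ^ _), ← Real.div_rpow hx.le hN0.le]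
        exact inv_anti₀ (by positivity) (Real.rpow_le_rpow (by positivity) e0 (by positivity))
      have e2 : (harmonic n : ℝ) ≤ 1 + Real.log ((n : ℝ) + 1) := by
        refine (harmonic_le_one_add_log n).trans ?_
        rcases Nat.eq_zero_or_pos n with rfl | hpos
        · simp
        · have : (0 : ℝ) < n := by exact_mod_cast hpos
          have := Real.log_le_log this (by linarith : (n : ℝ) ≤ n + 1)
          linarith
      have e3 : (0 : ℝ) ≤ (harmonic n : ℝ) := by
        rw [harmonic_eq_sum_Icc]; push_cast
        exact Finset.sum_nonneg fun _ _ => by positivity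
      calc n₀ * Real.exp (β n * (2 * η * (m + 1) - gap)) * (harmonic n : ℝ)
          ≤ n₀ * ((N : ℝ) ^ (β₀ * (gap / 2)) * ((n : ℝ) + 1) ^ (-(β₀ * (gap / 2))))
            * (1 + Real.log ((n : ℝ) + 1)) := by gcongr
        _ = _ := by ring
  have hlim := (tendsto_power_add_power_log (a := β₀ * (N * (Δ + 2 * η))) hη2
    (b := β₀ * (gap / 2)) (by positivity) (2 * (N * (2 * (N * n₀)) ^ N))
    (n₀ * (N : ℝ) ^ (β₀ * (gap / 2)))).add
    (tendsto_measureReal_exists_notMem (fun t => ℋ.le _ _ (hGd t)) hGdae)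
  rw [add_zero] at hlim
  exact tendsto_of_tendsto_of_tendsto_of_le_of_le' tendsto_const_nhds hlim
    (Eventually.of_forall fun _ => measureReal_nonneg) hbound

end Convergence

/-! ### Counts of a Poisson point process -/

section Poisson

/-- Multiplying the mass at n + 1 by n + 1 gives r times the mass at n, and the masses sum to one.
-/
theorem lintegral_natCast_poissonMeasure (r : ℝ≥0) :
    ∫⁻ n, (n : ℝ≥0∞) ∂(poissonMeasure r) = r := by
  rw [lintegral_countable']
  rw [tsum_eq_zero_add' ENNReal.summable]
  have h : ∀ n : ℕ, ((n + 1 : ℕ) : ℝ≥0∞) * poissonMeasure r {n + 1}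
      = r * poissonMeasure r {n} := by
    intro n
    rw [poissonMeasure_singleton, poissonMeasure_singleton, ← ENNReal.ofReal_natCast,
      ← ENNReal.ofReal_coe_nnreal, ← ENNReal.ofReal_mul (by positivity),
      ← ENNReal.ofReal_mul (by positivity)]
    congr 1
    rw [Nat.factorial_succ]
    push_cast
    field_simp
    ring
  simp_rw [h]
  rw [ENNReal.tsum_mul_left]
  have : ∑' n, poissonMeasure r {n} = 1 := by
    have := lintegral_countable' (μ := poissonMeasure r) (fun _ => 1)
    simpa using this.symm
  simp [this]

variable {Ω X : Type*} [MeasurableSpace Ω] [MeasurableSpace X] {μ : Measure Ω}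
  {ν : Measure X} {Φ : Ω → Set X}

/-- The Poisson probabilities of the finite counts already sum to one, which leaves no mass for an
infinite count. -/
theorem IsPoissonPointProcess.ae_finite [IsProbabilityMeasure μ] (hΦ : IsPoissonPointProcess μ ν Φ) {A : Set X}
    (hA : MeasurableSet A) (hνA : ν A ≠ ∞) : ∀ᵐ ω ∂μ, (Φ ω ∩ A).Finite := by
  have hm := hΦ.measurable_count A hA
  have hdisj : Pairwise (Function.onFun Disjoint
      fun n : ℕ => {ω | (Φ ω ∩ A).encard = (n : ℕ∞)}) := by
    intro m n hmn
    refine Set.disjoint_left.mpr fun ω h1 h2 => hmn ?_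
    exact_mod_cast (h1.symm.trans h2 : (m : ℕ∞) = n)
  have h1 : μ (⋃ n : ℕ, {ω | (Φ ω ∩ A).encard = (n : ℕ∞)}) = 1 := by
    rw [measure_iUnion hdisj fun n => hm (measurableSet_singleton _)]
    simp_rw [hΦ.count_law A hA hνA]
    have := lintegral_countable' (μ := poissonMeasure (ν A).toNNReal) (fun _ => 1)
    simpa using this.symm
  have h2 := (prob_compl_eq_zero_iff (MeasurableSet.iUnion fun n : ℕ =>
    hm (measurableSet_singleton (n : ℕ∞)))).mpr h1
  filter_upwards [measure_eq_zero_iff_ae_notMem.mp h2] with ω hω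
  simp only [Set.mem_compl_iff, Set.mem_iUnion, not_not] at hω
  obtain ⟨n, hn⟩ := hω
  exact Set.finite_of_encard_eq_coe hn

theorem IsPoissonPointProcess.lintegral_count [IsProbabilityMeasure μ] (hΦ : IsPoissonPointProcess μ ν Φ) {A : Set X}
    (hA : MeasurableSet A) (hνA : ν A ≠ ∞) :
    ∫⁻ ω, ((Φ ω ∩ A).encard : ℝ≥0∞) ∂μ = ν A := by
  have hm := hΦ.measurable_count A hA
  have hfin := hΦ.ae_finite hA hνA
  let Y : Ω → ℕ := fun ω => (Φ ω ∩ A).encard.toNat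
  have hY : Measurable Y := (measurable_from_top (f := ENat.toNat)).comp hm
  have hXY : ∀ᵐ ω ∂μ, (Φ ω ∩ A).encard = (Y ω : ℕ∞) := by
    filter_upwards [hfin] with ω hω
    exact (ENat.natCast_toNat (Set.encard_ne_top_iff.mpr hω)).symm
  have hlaw : μ.map Y = poissonMeasure (ν A).toNNReal := by
    refine Measure.ext_of_singleton fun n => ?_
    rw [Measure.map_apply hY (measurableSet_singleton n), ← hΦ.count_law A hA hνA n]
    refine measure_congr ?_
    filter_upwards [hXY] with ω hω
    refine propext ?_
    change Y ω = n ↔ (Φ ω ∩ A).encard = n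
    rw [hω]; norm_cast
  calc ∫⁻ ω, ((Φ ω ∩ A).encard : ℝ≥0∞) ∂μ = ∫⁻ ω, ((Y ω : ℕ) : ℝ≥0∞) ∂μ := by
        refine lintegral_congr_ae ?_
        filter_upwards [hXY] with ω hω
        rw [hω]; simp
    _ = ∫⁻ n, (n : ℝ≥0∞) ∂(μ.map Y) := (lintegral_map (by fun_prop) hY).symm
    _ = ν A := by
        rw [hlaw, lintegral_natCast_poissonMeasure, ENNReal.coe_toNNReal hνA]

theorem IsPoissonPointProcess.measureReal_empty (hΦ : IsPoissonPointProcess μ ν Φ) {A : Set X}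
    (hA : MeasurableSet A) (hνA : ν A ≠ ∞) :
    μ.real {ω | Φ ω ∩ A = ∅} = Real.exp (-(ν A).toReal) := by
  have := hΦ.count_law A hA hνA 0
  simp only [Nat.cast_zero, Set.encard_eq_zero] at this
  rw [measureReal_def, this, ← measureReal_def, poissonMeasure_real_singleton]
  simp [ENNReal.coe_toNNReal_eq_toReal]

theorem IsPoissonPointProcess.measurableSet_empty (hΦ : IsPoissonPointProcess μ ν Φ) {A : Set X}
    (hA : MeasurableSet A) : MeasurableSet {ω | Φ ω ∩ A = ∅} := by
  have := hΦ.measurable_count A hA (measurableSet_singleton 0)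
  simpa [Set.preimage, Set.encard_eq_zero] using this

theorem IsPoissonPointProcess.measureReal_nonempty_le [IsProbabilityMeasure μ] (hΦ : IsPoissonPointProcess μ ν Φ)
    {A : Set X} (hA : MeasurableSet A) (hνA : ν A ≠ ∞) :
    μ.real {ω | (Φ ω ∩ A).Nonempty} ≤ (ν A).toReal := by
  have e : {ω | (Φ ω ∩ A).Nonempty} = {ω | Φ ω ∩ A = ∅}ᶜ := by
    ext ω; simp [Set.nonempty_iff_ne_empty]
  rw [e, probReal_compl_eq_one_sub (hΦ.measurableSet_empty hA), hΦ.measureReal_empty hA hνA]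
  linarith [Real.add_one_le_exp (-(ν A).toReal)]

/-- With x the intensity, 1 - exp (-x) * (1 + x) ≤ 1 - (1 - x) * (1 + x) = x ^ 2. -/
theorem IsPoissonPointProcess.measureReal_nontrivial_le [IsProbabilityMeasure μ] (hΦ : IsPoissonPointProcess μ ν Φ)
    {A : Set X} (hA : MeasurableSet A) (hνA : ν A ≠ ∞) :
    μ.real {ω | (Φ ω ∩ A).Nontrivial} ≤ (ν A).toReal ^ 2 := by
  have hm := hΦ.measurable_count A hA
  have e : {ω | (Φ ω ∩ A).Nontrivial}
      = ({ω | (Φ ω ∩ A).encard = (0 : ℕ)} ∪ {ω | (Φ ω ∩ A).encard = (1 : ℕ)})ᶜ := by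
    ext ω
    simp only [Set.mem_ofPred_eq, Set.mem_compl_iff, Set.mem_union]
    rw [← Set.one_lt_encard_iff_nontrivial]
    generalize (Φ ω ∩ A).encard = c
    cases c with
    | top => simp
    | coe c =>
      norm_cast
      omega
  have hdisj : Disjoint {ω | (Φ ω ∩ A).encard = (0 : ℕ)} {ω | (Φ ω ∩ A).encard = (1 : ℕ)} := by
    refine Set.disjoint_left.mpr fun ω h1 h2 => ?_
    have := h1.symm.trans h2
    norm_num at this
  have hm' : ∀ n : ℕ, MeasurableSet {ω | (Φ ω ∩ A).encard = (n : ℕ∞)} :=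
    fun n => hm (measurableSet_singleton _)
  rw [e, probReal_compl_eq_one_sub ((hm' 0).union (hm' 1)), measureReal_union hdisj (hm' 1),
    measureReal_def, measureReal_def, hΦ.count_law A hA hνA, hΦ.count_law A hA hνA,
    ← measureReal_def, ← measureReal_def, poissonMeasure_real_singleton,
    poissonMeasure_real_singleton]
  simp only [ENNReal.coe_toNNReal_eq_toReal, pow_zero, pow_one, Nat.factorial_zero,
    Nat.factorial_one, Nat.cast_one, div_one, mul_one]
  set x := (ν A).toReal
  have hx : 0 ≤ x := ENNReal.toReal_nonneg
  have := Real.add_one_le_exp (-x)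
  nlinarith

end Poisson

/-! ### The intensity of the requests -/

section Intensity

variable {M N K : ℕ} (cell : Fin N → Set Plane) (lam : Fin M → ℝ≥0)

theorem volume_coverage_ne_top {cell : Fin N → Set Plane} (hfin : ∀ j, volume (cell j) ≠ ∞) :
    volume (coverage cell) ≠ ∞ := by
  refine ((measure_iUnion_fintype_le volume cell).trans_lt ?_).ne
  exact ENNReal.sum_lt_top.mpr fun j _ => (hfin j).lt_top

theorem requestIntensity_apply_of_section {A : Set (Request M)} (hA : MeasurableSet A)
    {U : Fin M → Set Plane} (hU : ∀ i, MeasurableSet (U i)) {a b : ℝ} (ha : 0 ≤ a)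
    (h : ∀ i x τ, (i, x, τ) ∈ A ↔ x ∈ U i ∧ τ ∈ Set.Ioc a b) :
    requestIntensity cell lam A
      = ∑ i, lam i * (volume (U i ∩ coverage cell) * ENNReal.ofReal (b - a)) := by
  rw [requestIntensity, Measure.coe_finsetSum, Finset.sum_apply]
  refine Finset.sum_congr rfl fun i _ => ?_
  rw [Measure.smul_apply, Measure.dirac_prod, Measure.map_apply measurable_prodMk_left hA]
  have e : Prod.mk i ⁻¹' A = U i ×ˢ Set.Ioc a b := by
    ext ⟨x, τ⟩; exact h i x τ
  have e2 : Set.Ioc a b ∩ Set.Ioi 0 = Set.Ioc a b :=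
    Set.inter_eq_left.mpr fun τ hτ => lt_of_le_of_lt ha hτ.1
  rw [e, Measure.prod_prod, Measure.restrict_apply (hU i),
    Measure.restrict_apply measurableSet_Ioc, e2, Real.volume_Ioc, smul_eq_mul]

/-- The requests with times in `(a, b]`. -/
def timeSlab (M : ℕ) (a b : ℝ) : Set (Request M) := {r | r.2.2 ∈ Set.Ioc a b}

theorem measurableSet_timeSlab (a b : ℝ) : MeasurableSet (timeSlab M a b) :=
  (measurable_snd.comp measurable_snd) measurableSet_Ioc

/-- The total rate of requests. -/
noncomputable def totalRate : ℝ := ∑ i, (lam i : ℝ) * (volume (coverage cell)).toReal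

theorem totalRate_nonneg : 0 ≤ totalRate cell lam :=
  Finset.sum_nonneg fun _ _ => by positivity

variable {cell}

theorem requestIntensity_ne_top_of_section (hfin : ∀ j, volume (cell j) ≠ ∞) {A : Set (Request M)} (hA : MeasurableSet A)
    {U : Fin M → Set Plane} (hU : ∀ i, MeasurableSet (U i)) {a b : ℝ} (ha : 0 ≤ a)
    (h : ∀ i x τ, (i, x, τ) ∈ A ↔ x ∈ U i ∧ τ ∈ Set.Ioc a b) :
    requestIntensity cell lam A ≠ ∞ := by
  rw [requestIntensity_apply_of_section cell lam hA hU ha h]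
  refine ENNReal.sum_ne_top.mpr fun i _ => ENNReal.mul_ne_top ENNReal.coe_ne_top
    (ENNReal.mul_ne_top ?_ ENNReal.ofReal_ne_top)
  exact ne_top_of_le_ne_top (volume_coverage_ne_top hfin) (measure_mono Set.inter_subset_right)

theorem requestIntensity_timeSlab_ne_top (hfin : ∀ j, volume (cell j) ≠ ∞) {a b : ℝ} (ha : 0 ≤ a) :
    requestIntensity cell lam (timeSlab M a b) ≠ ∞ :=
  requestIntensity_ne_top_of_section lam hfin (measurableSet_timeSlab a b)
    (U := fun _ => Set.univ) (a := a) (b := b) (fun _ => MeasurableSet.univ) ha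
    (by simp [timeSlab])

theorem requestIntensity_timeSlab_toReal {a b : ℝ} (ha : 0 ≤ a) (hab : a ≤ b) :
    (requestIntensity cell lam (timeSlab M a b)).toReal = totalRate cell lam * (b - a) := by
  rw [requestIntensity_apply_of_section cell lam (measurableSet_timeSlab a b)
    (U := fun _ => Set.univ) (a := a) (b := b) (fun _ => MeasurableSet.univ) ha
    (by simp [timeSlab])]
  simp_rw [← mul_assoc, ← Finset.sum_mul, Set.univ_inter]
  rw [ENNReal.toReal_mul, ENNReal.toReal_ofReal (by linarith), totalRate, ← Finset.sum_mul,
    ENNReal.toReal_mul, ENNReal.toReal_sum (by simp)]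
  simp

end Intensity

/-! ### Requests are locally finite and never simultaneous -/

section RequestTimes

variable {Ω : Type*} [MeasurableSpace Ω] {μ : Measure Ω} [IsProbabilityMeasure μ] {M N : ℕ}
  {cell : Fin N → Set Plane} {lam : Fin M → ℝ≥0} {Φ : Ω → Set (Request M)}

theorem ae_requestsBetween_finite (hΦ : IsPoissonPointProcess μ (requestIntensity cell lam) Φ)
    (hfin : ∀ j, volume (cell j) ≠ ∞) :
    ∀ᵐ ω ∂μ, ∀ a b : ℝ, 0 ≤ a → (requestsBetween (Φ ω) a b).Finite := by
  have : ∀ᵐ ω ∂μ, ∀ n : ℕ, (Φ ω ∩ timeSlab M 0 n).Finite :=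
    ae_all_iff.mpr fun n => hΦ.ae_finite (measurableSet_timeSlab _ _)
      (requestIntensity_timeSlab_ne_top lam hfin le_rfl)
  filter_upwards [this] with ω hω a b ha
  obtain ⟨n, hn⟩ := exists_nat_ge b
  refine (hω n).subset fun r hr => ⟨hr.1, ?_⟩
  exact ⟨lt_of_le_of_lt ha hr.2.1, hr.2.2.trans hn⟩

/-- Cut (0, L] into L * k slabs of length 1 / k. Simultaneous requests share a slab, which has
probability O(1 / k ^ 2) for each slab and O(1 / k) in total. -/
theorem ae_request_times_injective
    (hΦ : IsPoissonPointProcess μ (requestIntensity cell lam) Φ)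
    (hfin : ∀ j, volume (cell j) ≠ ∞) :
    ∀ᵐ ω ∂μ, ∀ r ∈ Φ ω, ∀ r' ∈ Φ ω, 0 < r.2.2 → r.2.2 = r'.2.2 → r = r' := by
  let bad : ℕ → Set Ω := fun L =>
    {ω | ∃ r ∈ Φ ω, ∃ r' ∈ Φ ω, r.2.2 ∈ Set.Ioc (0 : ℝ) L ∧ r.2.2 = r'.2.2 ∧ r ≠ r'}
  have hbad : ∀ L, μ (bad L) = 0 := by
    intro L
    set c : ℝ := totalRate cell lam with hc
    have hle : ∀ k : ℕ, 0 < k → μ.real (bad L) ≤ L * c ^ 2 * (k : ℝ)⁻¹ := by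
      intro k hk
      have hk0 : (0 : ℝ) < k := by exact_mod_cast hk
      let sl : ℕ → Set (Request M) := fun j => timeSlab M (j / k) ((j + 1) / k)
      have hsub : bad L ⊆ ⋃ j ∈ Finset.range (L * k), {ω | (Φ ω ∩ sl j).Nontrivial} := by
        rintro ω ⟨r, hr, r', hr', ⟨h0, hL⟩, heq, hne⟩
        have hpos : 0 < ⌈r.2.2 * k⌉₊ := Nat.ceil_pos.mpr (by positivity)
        obtain ⟨j, hj⟩ := Nat.exists_eq_add_of_lt hpos
        rw [zero_add] at hj
        have hj1 : (j : ℝ) < r.2.2 * k := Nat.lt_ceil.mp (by omega)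
        have hj2 : r.2.2 * k ≤ (j : ℝ) + 1 := by
          have := Nat.le_ceil (r.2.2 * k)
          rw [hj] at this
          exact_mod_cast this
        have hmem : r.2.2 ∈ Set.Ioc ((j : ℝ) / k) ((j + 1) / k) :=
          ⟨by rwa [div_lt_iff₀ hk0], by rwa [le_div_iff₀ hk0]⟩
        simp only [Set.mem_iUnion]
        refine ⟨j, ?_, r, ⟨hr, hmem⟩, r', ⟨hr', ?_⟩, hne⟩
        · rw [Finset.mem_range]
          have : (j : ℝ) < L * k := hj1.trans_le (by gcongr)
          exact_mod_cast this
        · rw [heq] at hmem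
          exact hmem
      have hone : ∀ j, μ.real {ω | (Φ ω ∩ sl j).Nontrivial} ≤ (c * (k : ℝ)⁻¹) ^ 2 := by
        intro j
        have h0 : (0 : ℝ) ≤ (j : ℝ) / k := by positivity
        refine (hΦ.measureReal_nontrivial_le (measurableSet_timeSlab _ _)
          (requestIntensity_timeSlab_ne_top lam hfin h0)).trans (le_of_eq ?_)
        rw [requestIntensity_timeSlab_toReal lam h0 (by gcongr; linarith)]
        congr 2
        field_simp
        ring
      calc μ.real (bad L) ≤ μ.real (⋃ j ∈ Finset.range (L * k), {ω | (Φ ω ∩ sl j).Nontrivial}) :=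
            measureReal_mono hsub (measure_ne_top _ _)
        _ ≤ ∑ j ∈ Finset.range (L * k), μ.real {ω | (Φ ω ∩ sl j).Nontrivial} :=
            measureReal_biUnion_finset_le _ _
        _ ≤ (L * k) * (c * (k : ℝ)⁻¹) ^ 2 :=
            (Finset.sum_le_card_nsmul _ _ _ fun j _ => hone j).trans (by simp)
        _ = L * c ^ 2 * (k : ℝ)⁻¹ := by field_simp
    have hlim : Tendsto (fun k : ℕ => L * c ^ 2 * (k : ℝ)⁻¹) atTop (𝓝 (L * c ^ 2 * 0)) :=
      tendsto_inv_atTop_nhds_zero_nat.const_mul _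
    rw [mul_zero] at hlim
    have h0 : μ.real (bad L) ≤ 0 :=
      ge_of_tendsto hlim ((eventually_gt_atTop 0).mono fun k hk => hle k hk)
    exact (measureReal_eq_zero_iff).mp (le_antisymm h0 measureReal_nonneg)
  have : ∀ᵐ ω ∂μ, ∀ L, ω ∉ bad L :=
    ae_all_iff.mpr fun L => measure_eq_zero_iff_ae_notMem.mp (hbad L)
  filter_upwards [this] with ω hω r hr r' hr' h0 heq
  by_contra hne
  obtain ⟨L, hL⟩ := exists_nat_ge r.2.2
  exact hω L ⟨r, hr, r', hr', ⟨h0, hL⟩, heq, hne⟩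

end RequestTimes

/-! ### The hit rate as a potential for the station energies -/

section HitRate

variable {M N K : ℕ} {cell : Fin N → Set Plane}

theorem mem_region {s : Finset (Fin N)} {x : Plane} :
    x ∈ region cell s ↔ x ∈ coverage cell ∧ ∀ j, x ∈ cell j ↔ j ∈ s := by
  simp only [region, Set.mem_inter_iff, Set.mem_iInter, Set.mem_compl_iff, Set.mem_iUnion,
    Finset.mem_compl, not_exists]
  constructor
  · rintro ⟨⟨h1, h2⟩, h3⟩
    refine ⟨h1, fun j => ⟨fun hx => ?_, h2 j⟩⟩
    by_contra hj
    exact h3 j hj hx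
  · rintro ⟨h1, h2⟩
    exact ⟨⟨h1, fun j hj => (h2 j).mpr hj⟩, fun j hj hx => hj ((h2 j).mp hx)⟩

theorem measurableSet_region (hcell : ∀ j, MeasurableSet (cell j)) (s : Finset (Fin N)) :
    MeasurableSet (region cell s) :=
  ((MeasurableSet.iUnion hcell).inter (MeasurableSet.iInter fun j => MeasurableSet.iInter fun _ =>
    hcell j)).inter (MeasurableSet.iUnion fun j => MeasurableSet.iUnion fun _ => hcell j).compl

theorem volume_region_ne_top (hfin : ∀ j, volume (cell j) ≠ ∞) (s : Finset (Fin N)) :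
    volume (region cell s) ≠ ∞ :=
  ne_top_of_le_ne_top (volume_coverage_ne_top hfin)
    (measure_mono fun _ hx => (mem_region.mp hx).1)

/-- The set of points covered by a station that stores content `i`. -/
def servedRegion (cell : Fin N → Set Plane) (B : Config M N K) (i : Fin M) : Set Plane :=
  {x | ∃ j, x ∈ cell j ∧ i ∈ B.1 j}

theorem servedRegion_subset (B : Config M N K) (i : Fin M) :
    servedRegion cell B i ⊆ coverage cell := fun _ ⟨j, hj, _⟩ => Set.mem_iUnion.mpr ⟨j, hj⟩

theorem measurableSet_servedRegion (hcell : ∀ j, MeasurableSet (cell j)) (B : Config M N K)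
    (i : Fin M) : MeasurableSet (servedRegion cell B i) := by
  have : servedRegion cell B i = ⋃ j, ⋃ (_ : i ∈ B.1 j), cell j := by
    ext x
    simp only [servedRegion, Set.mem_ofPred_eq, Set.mem_iUnion, exists_prop]
    exact exists_congr fun j => and_comm
  rw [this]
  exact MeasurableSet.iUnion fun j => MeasurableSet.iUnion fun _ => hcell j

theorem volume_servedRegion (hcell : ∀ j, MeasurableSet (cell j))
    (hfin : ∀ j, volume (cell j) ≠ ∞) (B : Config M N K) (i : Fin M) :
    (volume (servedRegion cell B i)).toReal
      = ∑ s : Finset (Fin N), if ∃ k ∈ s, i ∈ B.1 k then regionArea cell s else 0 := by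
  classical
  have e : servedRegion cell B i
      = ⋃ s ∈ Finset.univ.filter fun s : Finset (Fin N) => ∃ k ∈ s, i ∈ B.1 k, region cell s := by
    ext x
    simp only [Set.mem_iUnion, Finset.mem_filter, Finset.mem_univ, true_and, exists_prop]
    constructor
    · rintro ⟨j, hj, hi⟩
      refine ⟨Finset.univ.filter fun j => x ∈ cell j, ⟨j, by simp [hj], hi⟩, ?_⟩
      exact mem_region.mpr ⟨Set.mem_iUnion.mpr ⟨j, hj⟩, fun k => by simp⟩
    · rintro ⟨s, ⟨k, hk, hi⟩, hx⟩
      exact ⟨k, ((mem_region.mp hx).2 k).mpr hk, hi⟩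
  rw [e, ← measureReal_def, measureReal_biUnion_finset ?_ ?_ (fun s _ => volume_region_ne_top hfin s),
    Finset.sum_filter]
  · rfl
  · intro s _ t _ hst
    refine Set.disjoint_left.mpr fun x h1 h2 => hst ?_
    ext j
    rw [← (mem_region.mp h1).2 j, (mem_region.mp h2).2 j]
  · exact fun s _ => measurableSet_region hcell s

/-- The hit rate of a configuration in terms of the rates and the areas of the regions. -/
noncomputable def coverageRate (cell : Fin N → Set Plane) (lam : Fin M → ℝ≥0)
    (B : Config M N K) : ℝ :=
  ∑ s : Finset (Fin N), ∑ i, if ∃ k ∈ s, i ∈ B.1 k then (lam i : ℝ) * regionArea cell s else 0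

/-- The mean of a Poisson count is its intensity, and the served part of the plane splits according
to the exact set of covering stations. -/
theorem hitRate_eq_coverageRate {Ω : Type*} [MeasurableSpace Ω] {μ : Measure Ω}
    [IsProbabilityMeasure μ] {lam : Fin M → ℝ≥0} {Φ : Ω → Set (Request M)}
    (hΦ : IsPoissonPointProcess μ (requestIntensity cell lam) Φ)
    (hcell : ∀ j, MeasurableSet (cell j)) (hfin : ∀ j, volume (cell j) ≠ ∞) (B : Config M N K) :
    hitRate μ Φ cell B = coverageRate cell lam B := by
  have hsec : ∀ i x τ, (i, x, τ) ∈ hitSet cell B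
      ↔ x ∈ servedRegion cell B i ∧ τ ∈ Set.Ioc (0 : ℝ) 1 := fun i x τ => and_comm
  have hmeas : MeasurableSet (hitSet cell B) := by
    have : hitSet cell B = timeSlab M 0 1 ∩
        ⋃ i, (Prod.fst ⁻¹' {i} ∩ (fun r => r.2.1) ⁻¹' (servedRegion cell B i)) := by
      ext r
      simp only [hitSet, timeSlab, servedRegion, Set.mem_inter_iff, Set.mem_iUnion,
        Set.mem_preimage, Set.mem_singleton_iff, Set.mem_ofPred_eq, exists_eq_left']
    rw [this]
    exact (measurableSet_timeSlab _ _).inter (MeasurableSet.iUnion fun i =>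
      (measurable_fst (measurableSet_singleton i)).inter
        ((measurable_fst.comp measurable_snd) (measurableSet_servedRegion hcell B i)))
  rw [hitRate, hΦ.lintegral_count hmeas (requestIntensity_ne_top_of_section lam hfin hmeas
      (measurableSet_servedRegion hcell B) le_rfl hsec),
    requestIntensity_apply_of_section cell lam hmeas (measurableSet_servedRegion hcell B) le_rfl
      hsec, coverageRate, Finset.sum_comm]
  have hv : ∀ i, volume (servedRegion cell B i) ≠ ∞ := fun i =>
    ne_top_of_le_ne_top (volume_coverage_ne_top hfin) (measure_mono (servedRegion_subset B i))
  rw [ENNReal.toReal_sum]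
  · refine Finset.sum_congr rfl fun i _ => ?_
    rw [Set.inter_eq_left.mpr (servedRegion_subset B i), sub_zero, ENNReal.ofReal_one, mul_one,
      ENNReal.toReal_mul, volume_servedRegion hcell hfin, Finset.mul_sum]
    refine Finset.sum_congr rfl fun s _ => ?_
    split_ifs <;> simp
  · intro i _
    rw [Set.inter_eq_left.mpr (servedRegion_subset B i)]
    exact ENNReal.mul_ne_top ENNReal.coe_ne_top (ENNReal.mul_ne_top (hv i) ENNReal.ofReal_ne_top)

/-- The local hit rates share each hit equally among the stations able to serve it, so adding them
up over the neighbours counts every hit in a region covered by j once. -/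
theorem stationEnergy_eq (lam : Fin M → ℝ≥0) (j : Fin N) (A : Config M N K) :
    stationEnergy cell (fun i s => (lam i : ℝ) * regionArea cell s) j A
      = ∑ s with j ∈ s, ∑ i, if ∃ k ∈ s, i ∈ A.1 k then (lam i : ℝ) * regionArea cell s else 0 := by
  classical
  unfold stationEnergy
  rw [Finset.sum_comm]
  refine Finset.sum_congr rfl fun s hs => ?_
  have hj : j ∈ s := (Finset.mem_filter.mp hs).2
  unfold localHitRate
  rw [Finset.sum_comm]
  refine Finset.sum_congr rfl fun i _ => ?_
  -- A region of nonzero area contains a point, which shows that every station of s is a neighbour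
  -- of j; null regions contribute nothing.
  by_cases h0 : regionArea cell s = 0
  · simp [h0]
  have hne : (region cell s).Nonempty := by
    by_contra h
    rw [Set.not_nonempty_iff_eq_empty] at h
    exact h0 (by simp [regionArea, h])
  obtain ⟨x, hx⟩ := hne
  have hx' := (mem_region.mp hx).2
  have e : (neighbours cell j).filter (fun n => i ∈ A.1 n ∧ n ∈ s)
      = s.filter fun k => i ∈ A.1 k := by
    ext n
    simp only [neighbours, Finset.mem_filter, Finset.mem_univ, true_and]
    constructor
    · exact fun h => ⟨h.2.2, h.2.1⟩
    · exact fun h => ⟨⟨x, (hx' j).mpr hj, (hx' n).mpr h.1⟩, h.2, h.1⟩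
  rw [← Finset.sum_filter, e, Finset.sum_const, nsmul_eq_mul]
  split_ifs with hk
  · obtain ⟨k, hk, hik⟩ := hk
    have hpos : 1 ≤ (s.filter fun k => i ∈ A.1 k).card :=
      Finset.card_pos.mpr ⟨k, Finset.mem_filter.mpr ⟨hk, hik⟩⟩
    rw [max_eq_right hpos]
    have : ((s.filter fun k => i ∈ A.1 k).card : ℝ) ≠ 0 := by
      exact_mod_cast (by omega : (s.filter fun k => i ∈ A.1 k).card ≠ 0)
    field_simp
  · have : (s.filter fun k => i ∈ A.1 k) = ∅ := by
      ext k
      simp only [Finset.mem_filter, Finset.notMem_empty, iff_false]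
      exact fun h => hk ⟨k, h.1, h.2⟩
    simp [this]

/-- The difference collects the hits in regions that j does not cover, and these do not involve
column j. -/
theorem stationEnergy_sub_coverageRate (lam : Fin M → ℝ≥0) {j : Fin N} {A B : Config M N K}
    (h : AgreeOff j A B) :
    stationEnergy cell (fun i s => (lam i : ℝ) * regionArea cell s) j A - coverageRate cell lam A
      = stationEnergy cell (fun i s => (lam i : ℝ) * regionArea cell s) j B
        - coverageRate cell lam B := by
  have e : ∀ A : Config M N K,
      stationEnergy cell (fun i s => (lam i : ℝ) * regionArea cell s) j A - coverageRate cell lam A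
      = - ∑ s with j ∉ s, ∑ i, if ∃ k ∈ s, i ∈ A.1 k then (lam i : ℝ) * regionArea cell s
        else 0 := by
    intro A
    rw [stationEnergy_eq, coverageRate, ← Finset.sum_filter_add_sum_filter_not Finset.univ
      (fun s : Finset (Fin N) => j ∈ s)]
    ring
  rw [e, e, neg_inj]
  refine Finset.sum_congr rfl fun s hs => Finset.sum_congr rfl fun i _ => ?_
  have hj : j ∉ s := (Finset.mem_filter.mp hs).2
  have : (∃ k ∈ s, i ∈ A.1 k) ↔ ∃ k ∈ s, i ∈ B.1 k := by
    refine exists_congr fun k => and_congr_right fun hk => ?_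
    rw [h k (fun h' => hj (h' ▸ hk))]
  simp only [this]

theorem regionArea_nonneg (s : Finset (Fin N)) : 0 ≤ regionArea cell s := ENNReal.toReal_nonneg

/-- Contents stored by a unique maximizer are requested at a positive rate. -/
theorem lam_pos_of_mem_unique_maximizer (hKM : K < M) {lam : Fin M → ℝ≥0} {o : Config M N K}
    (ho : ∀ A, A ≠ o → coverageRate cell lam A < coverageRate cell lam o) {j : Fin N} {i : Fin M}
    (hi : i ∈ o.1 j) : 0 < lam i := by
  by_contra hlam
  have hlam : lam i = 0 := by simpa using hlam
  obtain ⟨k, hk⟩ : ∃ k, k ∉ o.1 j := by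
    by_contra! h
    have h1 : o.1 j = Finset.univ := Finset.eq_univ_iff_forall.mpr h
    have := o.2 j
    rw [h1, Finset.card_univ, Fintype.card_fin] at this
    omega
  have hki : k ≠ i := fun h => hk (h ▸ hi)
  -- Exchanging a content of rate zero for one absent from the cache loses no hits, contrary to
  -- strict maximality.
  let A : Config M N K := ⟨Function.update o.1 j (insert k ((o.1 j).erase i)), fun n => by
    by_cases hn : n = j
    · subst hn
      rw [Function.update_self, Finset.card_insert_of_notMem (by simp [hk]),
        Finset.card_erase_add_one hi, o.2]
    · rw [Function.update_of_ne hn, o.2]⟩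
  have hAj : A.1 j = insert k ((o.1 j).erase i) := Function.update_self _ _ _
  have hAn : ∀ n, n ≠ j → A.1 n = o.1 n := fun n hn => Function.update_of_ne hn _ _
  have hne : A ≠ o := fun h => by
    have : k ∈ A.1 j := by rw [hAj]; simp
    exact hk (h ▸ this)
  refine absurd (ho A hne) (not_lt.mpr ?_)
  refine Finset.sum_le_sum fun s _ => Finset.sum_le_sum fun i' _ => ?_
  by_cases hii : i' = i
  · subst hii; simp [hlam]
  · have hmono : (∃ n ∈ s, i' ∈ o.1 n) → ∃ n ∈ s, i' ∈ A.1 n := by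
      rintro ⟨n, hn, hin⟩
      refine ⟨n, hn, ?_⟩
      by_cases hnj : n = j
      · subst hnj; rw [hAj]; simp [hii, hin]
      · rwa [hAn n hnj]
    have hnn : 0 ≤ (lam i' : ℝ) * regionArea cell s :=
      mul_nonneg (lam i').2 (regionArea_nonneg s)
    by_cases h1 : ∃ n ∈ s, i' ∈ o.1 n
    · rw [if_pos h1, if_pos (hmono h1)]
    · rw [if_neg h1]
      split_ifs
      · exact hnn
      · exact le_rfl

end HitRate

/-! ### Pathwise behaviour of the real caches -/

section RealCachePath

variable {M N K : ℕ} {cell : Fin N → Set Plane}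

/-- The region covered only by station `j`. -/
def ownRegion (cell : Fin N → Set Plane) (j : Fin N) : Set Plane :=
  cell j ∩ (⋃ n ∈ ({j}ᶜ : Set (Fin N)), cell n)ᶜ

theorem eq_of_mem_ownRegion {j k : Fin N} {x : Plane} (hx : x ∈ ownRegion cell j)
    (hk : x ∈ cell k) : k = j := by
  by_contra hne
  exact hx.2 (Set.mem_biUnion (Set.mem_compl_singleton_iff.mpr hne) hk)

/-- Evictions only hit contents outside the reference cache. -/
theorem RealCacheStep.mem_of_mem {W R R' : Config M N K} {i : Fin M} {x : Plane}
    (h : RealCacheStep cell W i x R R') {i' : Fin M} {j' : Fin N} (hW : i' ∈ W.1 j')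
    (hR : i' ∈ R.1 j') : i' ∈ R'.1 j' := by
  obtain ⟨j, -, -, ⟨-, rfl⟩ | ⟨-, -, rfl⟩ | ⟨-, -, k, -, -, hkW, hR'⟩⟩ := h
  · exact hR
  · exact hR
  · rw [hR']
    by_cases hj : j' = j
    · subst hj
      rw [Function.update_self]
      exact Finset.mem_insert_of_mem (Finset.mem_erase.mpr ⟨fun h => hkW (h ▸ hW), hR⟩)
    · rwa [Function.update_of_ne hj]

/-- No other station covers x, so j must serve the request, whatever the rule for choosing the
server. -/
theorem RealCacheStep.mem_of_ownRegion {W R R' : Config M N K} {i : Fin M} {x : Plane}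
    (h : RealCacheStep cell W i x R R') {j : Fin N} (hx : x ∈ ownRegion cell j)
    (hW : i ∈ W.1 j) : i ∈ R'.1 j := by
  obtain ⟨j', hj', -, h⟩ := h
  obtain rfl := eq_of_mem_ownRegion hx hj'
  obtain ⟨hi, rfl⟩ | ⟨-, hi, -⟩ | ⟨-, -, k, -, -, -, hR'⟩ := h
  · exact hi
  · exact absurd hW hi
  · rw [hR', Function.update_self]
    exact Finset.mem_insert_self _ _

variable {P : Set (Request M)} {ρ : ℝ → Config M N K} {ref : ℝ → Config M N K} {W : Config M N K}
  {a b : ℝ}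

/-- The contents of the reference configuration that have been requested in the own region of a
station storing them are in the real cache of that station. -/
theorem mem_of_requested
    (hfinite : ∀ a b : ℝ, 0 ≤ a → (requestsBetween P a b).Finite)
    (hinj : ∀ r ∈ P, ∀ r' ∈ P, 0 < r.2.2 → r.2.2 = r'.2.2 → r = r')
    (hno : ∀ a τ : ℝ, 0 ≤ a → a < τ → requestsBetween P a τ = ∅ → ρ τ = ρ a)
    (hstep : ∀ a τ : ℝ, 0 ≤ a → a < τ → ∀ (i : Fin M) (x : Plane),
      requestsBetween P a τ = {(i, x, τ)} → RealCacheStep cell (ref τ) i x (ρ a) (ρ τ))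
    (ha : 0 ≤ a) (hW : ∀ τ ∈ Set.Ioc a b, ref τ = W) :
    ∀ c ≤ b, ∀ r ∈ requestsBetween P a c, ∀ j, r.2.1 ∈ ownRegion cell j → r.1 ∈ W.1 j →
      r.1 ∈ (ρ c).1 j := by
  suffices ∀ (n : ℕ) (c : ℝ), (requestsBetween P a c).ncard ≤ n → c ≤ b →
      ∀ r ∈ requestsBetween P a c, ∀ j, r.2.1 ∈ ownRegion cell j → r.1 ∈ W.1 j →
      r.1 ∈ (ρ c).1 j from fun c hc => this _ c le_rfl hc
  intro n
  induction n with
  | zero =>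
    intro c hn _ r hr
    rw [Nat.le_zero, Set.ncard_eq_zero (hfinite a c ha)] at hn
    rw [hn] at hr
    exact absurd hr (Set.notMem_empty r)
  | succ n ih =>
    intro c hn hcb r hr j hj hrW
    obtain ⟨⟨i₁, x₁, τ₁⟩, hr₁, hmax⟩ := Set.exists_max_image (requestsBetween P a c)
      (fun r => r.2.2) (hfinite a c ha) ⟨r, hr⟩
    have haτ : a < τ₁ := hr₁.2.1
    have hτc : τ₁ ≤ c := hr₁.2.2
    let S' := requestsBetween P a c \ {(i₁, x₁, τ₁)}
    have hS'lt : ∀ r' ∈ S', r'.2.2 < τ₁ := by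
      intro r' hr'
      refine lt_of_le_of_ne (hmax r' hr'.1) fun h => hr'.2 ?_
      exact hinj r' hr'.1.1 _ hr₁.1 (ha.trans_lt hr'.1.2.1) h
    -- The time of the last request but one, or a if there is none: (a', τ₁] then contains only the
    -- last request, and the induction applies up to a'.
    obtain ⟨a', ha', ha'max⟩ := Set.exists_max_image (insert a ((fun r : Request M => r.2.2) '' S'))
      id ((((hfinite a c ha).subset Set.sdiff_subset).image _).insert a) ⟨a, Set.mem_insert _ _⟩
    have haa' : a ≤ a' := ha'max a (Set.mem_insert _ _)
    have ha'τ : a' < τ₁ := by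
      rcases ha' with rfl | ⟨r', hr', rfl⟩
      · exact haτ
      · exact hS'lt r' hr'
    have hS'a' : ∀ r' ∈ S', r' ∈ requestsBetween P a a' := fun r' hr' =>
      ⟨hr'.1.1, hr'.1.2.1, ha'max _ (Set.mem_insert_of_mem _ ⟨r', hr', rfl⟩)⟩
    have hsingle : requestsBetween P a' τ₁ = {(i₁, x₁, τ₁)} := by
      ext r'
      constructor
      · intro hr'
        by_contra hne
        have hmem : r' ∈ S' := ⟨⟨hr'.1, haa'.trans_lt hr'.2.1, hr'.2.2.trans hτc⟩, hne⟩
        exact absurd hr'.2.1 (not_lt.mpr (hS'a' r' hmem).2.2)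
      · rintro rfl
        exact ⟨hr₁.1, ha'τ, le_rfl⟩
    have hρc : ρ c = ρ τ₁ := by
      rcases hτc.eq_or_lt with rfl | hlt
      · rfl
      · refine hno τ₁ c (ha.trans haτ.le) hlt (Set.eq_empty_iff_forall_notMem.mpr fun r' hr' => ?_)
        exact absurd hr'.2.1 (not_lt.mpr (hmax r' ⟨hr'.1, haτ.trans hr'.2.1, hr'.2.2⟩))
    have hst := hstep a' τ₁ (ha.trans haa') ha'τ i₁ x₁ hsingle
    rw [hW τ₁ ⟨haτ, hτc.trans hcb⟩] at hst
    rw [hρc]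
    by_cases hrr : r = (i₁, x₁, τ₁)
    · subst hrr
      exact hst.mem_of_ownRegion hj hrW
    · have hcard : (requestsBetween P a a').ncard ≤ n := by
        have hlt : (requestsBetween P a a').ncard < (requestsBetween P a c).ncard := by
          refine Set.ncard_lt_ncard ?_ (hfinite a c ha)
          refine ⟨fun r' hr' => ⟨hr'.1, hr'.2.1, hr'.2.2.trans (ha'τ.le.trans hτc)⟩, fun h => ?_⟩
          exact absurd (h hr₁).2.2 (not_le.mpr ha'τ)
        omega
      exact hst.mem_of_mem hrW
        (ih a' hcard (ha'τ.le.trans (hτc.trans hcb)) r (hS'a' r ⟨hr, hrr⟩) j hj hrW)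

/-- If the reference configuration is constant and each of its contents is requested in the own
region of each station storing it, then the real caches reach the reference configuration. -/
theorem eq_of_all_requested
    (hfinite : ∀ a b : ℝ, 0 ≤ a → (requestsBetween P a b).Finite)
    (hinj : ∀ r ∈ P, ∀ r' ∈ P, 0 < r.2.2 → r.2.2 = r'.2.2 → r = r')
    (hno : ∀ a τ : ℝ, 0 ≤ a → a < τ → requestsBetween P a τ = ∅ → ρ τ = ρ a)
    (hstep : ∀ a τ : ℝ, 0 ≤ a → a < τ → ∀ (i : Fin M) (x : Plane),
      requestsBetween P a τ = {(i, x, τ)} → RealCacheStep cell (ref τ) i x (ρ a) (ρ τ))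
    (ha : 0 ≤ a) (hW : ∀ τ ∈ Set.Ioc a b, ref τ = W)
    (hall : ∀ j, ∀ i ∈ W.1 j, ∃ r ∈ requestsBetween P a b, r.1 = i ∧ r.2.1 ∈ ownRegion cell j) :
    ρ b = W := by
  refine Subtype.ext (funext fun j => (Finset.eq_of_subset_of_card_le (fun i hi => ?_) ?_).symm)
  · obtain ⟨r, hr, rfl, hrj⟩ := hall j i hi
    exact mem_of_requested hfinite hinj hno hstep ha hW b le_rfl r hr j hrj hi
  · rw [W.2, (ρ b).2]

end RealCachePath

/-! ### The epochs at which the reference configuration is renewed -/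

section Epochs

variable {T : ℕ → ℝ}

theorem epoch_succ (T : ℕ → ℝ) (l : ℕ) : epoch T (l + 1) = epoch T l + T l :=
  Finset.sum_range_succ _ _

theorem strictMono_epoch (hT : ∀ k, 0 < T k) : StrictMono (epoch T) :=
  strictMono_nat_of_lt_succ fun l => by rw [epoch_succ]; linarith [hT l]

theorem epoch_nonneg (hT : ∀ k, 0 < T k) (l : ℕ) : 0 ≤ epoch T l :=
  Finset.sum_nonneg fun k _ => (hT k).le

theorem tendsto_epoch (hT : ∀ k, 0 < T k) (hmono : Monotone T) :
    Tendsto (epoch T) atTop atTop := by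
  refine tendsto_atTop_mono (f := fun l : ℕ => (l : ℝ) * T 0) (fun l => ?_)
    (tendsto_natCast_atTop_atTop.atTop_mul_const (hT 0))
  have := Finset.card_nsmul_le_sum (Finset.range l) T (T 0) fun k _ => hmono (Nat.zero_le k)
  simpa [epoch] using this

theorem lastEpoch_eq (hT : ∀ k, 0 < T k) {l : ℕ} {τ : ℝ} (h1 : epoch T l ≤ τ)
    (h2 : τ < epoch T (l + 1)) : lastEpoch T τ = epoch T l := by
  have : {l : ℕ | epoch T l ≤ τ} = Set.Iic l := by
    ext m
    constructor
    · intro hm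
      exact Nat.lt_succ_iff.mp ((strictMono_epoch hT).lt_iff_lt.mp (lt_of_le_of_lt hm h2))
    · intro hm
      exact ((strictMono_epoch hT).monotone hm).trans h1
  rw [lastEpoch, this, csSup_Iic]

theorem exists_epoch_le_lt (hT : ∀ k, 0 < T k) (hmono : Monotone T) {τ : ℝ} (hτ : 0 ≤ τ) :
    ∃ l, epoch T l ≤ τ ∧ τ < epoch T (l + 1) := by
  have hex : ∃ l, τ < epoch T l := ((tendsto_epoch hT hmono).eventually_gt_atTop τ).exists
  classical
  have hspec := Nat.find_spec hex
  have h0 : Nat.find hex ≠ 0 := fun h => by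
    rw [h] at hspec
    simp only [epoch, Finset.range_zero, Finset.sum_empty] at hspec
    linarith
  obtain ⟨l, hl⟩ := Nat.exists_eq_succ_of_ne_zero h0
  refine ⟨l, not_lt.mp (Nat.find_min hex (by omega)), ?_⟩
  rw [hl] at hspec
  exact hspec

theorem tendsto_leftSlot_epoch (hT : ∀ k, 0 < T k) (hmono : Monotone T) :
    Tendsto (fun l => leftSlot (epoch T l)) atTop atTop := by
  refine tendsto_atTop.mpr fun n => ?_
  filter_upwards [(tendsto_epoch hT hmono).eventually_ge_atTop ((n : ℝ) + 1)] with l hl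
  have : n + 1 ≤ ⌈epoch T l⌉₊ := by
    have := hl.trans (Nat.le_ceil _)
    exact_mod_cast this
  unfold leftSlot
  omega

end Epochs

/-! ### Time averages -/

/-- The time averages of a function that converges converge to the same limit. -/
theorem tendsto_integral_div {f : ℝ → ℝ} {c : ℝ} (hf : ContinuousOn f (Set.Ici 0))
    (hlim : Tendsto f atTop (𝓝 c)) :
    Tendsto (fun t : ℝ => (∫ τ in (0 : ℝ)..t, f τ) / t) atTop (𝓝 c) := by
  have hint : ∀ {a b : ℝ}, 0 ≤ a → 0 ≤ b → IntervalIntegrable (fun τ => f τ - c) volume a b := by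
    intro a b ha hb
    refine ContinuousOn.intervalIntegrable ((hf.mono fun x hx => ?_).sub continuousOn_const)
    exact (le_min ha hb).trans hx.1
  rw [Metric.tendsto_atTop]
  intro ε hε
  obtain ⟨A, hA⟩ := Metric.tendsto_atTop.mp hlim (ε / 2) (half_pos hε)
  set A' := max A 0
  have hA'0 : 0 ≤ A' := le_max_right _ _
  set D := |∫ τ in (0 : ℝ)..A', (f τ - c)|
  have hD0 : 0 ≤ D := abs_nonneg _
  refine ⟨max A' (2 * D / ε) + 1, fun t ht => ?_⟩
  have ht1 : A' < t := by linarith [le_max_left A' (2 * D / ε)]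
  have ht2 : 2 * D / ε < t := by linarith [le_max_right A' (2 * D / ε)]
  have ht0 : 0 < t := hA'0.trans_lt ht1
  have h1 : (∫ τ in (0 : ℝ)..t, f τ) / t - c = (∫ τ in (0 : ℝ)..t, (f τ - c)) / t := by
    have hfi : IntervalIntegrable f volume 0 t := by
      have := (hint le_rfl ht0.le).add (intervalIntegrable_const (c := c))
      simpa using this
    rw [intervalIntegral.integral_sub hfi intervalIntegrable_const]
    simp only [intervalIntegral.integral_const, sub_zero, smul_eq_mul]
    field_simp
  have h2 : |∫ τ in A'..t, (f τ - c)| ≤ ε / 2 * |t - A'| := by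
    rw [← Real.norm_eq_abs]
    refine intervalIntegral.norm_integral_le_of_norm_le_const fun τ hτ => ?_
    rw [Set.uIoc_of_le ht1.le] at hτ
    have := hA τ ((le_max_left A 0).trans hτ.1.le)
    rw [Real.dist_eq] at this
    exact this.le
  rw [Real.dist_eq, h1, abs_div, abs_of_pos ht0, div_lt_iff₀ ht0,
    ← intervalIntegral.integral_add_adjacent_intervals (hint le_rfl hA'0) (hint hA'0 ht0.le)]
  rw [abs_of_pos (sub_pos.mpr ht1)] at h2
  rw [div_lt_iff₀ hε] at ht2
  calc |(∫ τ in (0 : ℝ)..A', (f τ - c)) + ∫ τ in A'..t, (f τ - c)| ≤ D + ε / 2 * (t - A') :=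
        (abs_add_le _ _).trans (add_le_add le_rfl h2)
    _ < ε * t := by nlinarith

/-! ### Convergence of the real caches -/

section RealCaches

variable {Ω : Type*} [MeasurableSpace Ω] {μ : Measure Ω} {M N K : ℕ}
  {cell : Fin N → Set Plane} {lam : Fin M → ℝ≥0} {Φ : Ω → Set (Request M)} {T : ℕ → ℝ}
  {V : ℕ → Ω → Config M N K} {R : ℝ → Ω → Config M N K}

theorem measurableSet_ownRegion (hcell : ∀ j, MeasurableSet (cell j)) (j : Fin N) :
    MeasurableSet (ownRegion cell j) :=
  (hcell j).inter (MeasurableSet.iUnion fun n => MeasurableSet.iUnion fun _ => hcell n).compl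

/-- The requests for content `i` in the own region of station `j` during `(a, b]`. -/
def ownRequests (cell : Fin N → Set Plane) (i : Fin M) (j : Fin N) (a b : ℝ) :
    Set (Request M) :=
  {r | r.1 = i ∧ r.2.1 ∈ ownRegion cell j ∧ r.2.2 ∈ Set.Ioc a b}

theorem measureReal_no_ownRequests (hΦ : IsPoissonPointProcess μ (requestIntensity cell lam) Φ)
    (hcell : ∀ j, MeasurableSet (cell j)) (hfin : ∀ j, volume (cell j) ≠ ∞) (i : Fin M)
    (j : Fin N) {a b : ℝ} (ha : 0 ≤ a) (hab : a ≤ b) :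
    μ.real {ω | Φ ω ∩ ownRequests cell i j a b = ∅}
      = Real.exp (-((lam i : ℝ) * (volume (ownRegion cell j)).toReal * (b - a))) := by
  classical
  have hmeas : MeasurableSet (ownRequests cell i j a b) :=
    (measurable_fst (measurableSet_singleton i)).inter
      (((measurable_fst.comp measurable_snd) (measurableSet_ownRegion hcell j)).inter
        (measurableSet_timeSlab (M := M) a b))
  let U : Fin M → Set Plane := fun i' => if i' = i then ownRegion cell j else ∅
  have hU : ∀ i', MeasurableSet (U i') := fun i' => by
    simp only [U]
    split_ifs
    · exact measurableSet_ownRegion hcell j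
    · exact MeasurableSet.empty
  have hsec : ∀ i' x τ, (i', x, τ) ∈ ownRequests cell i j a b ↔ x ∈ U i' ∧ τ ∈ Set.Ioc a b := by
    intro i' x τ
    simp only [ownRequests, Set.mem_ofPred_eq, U]
    split_ifs with h <;> simp [h]
  rw [hΦ.measureReal_empty hmeas (requestIntensity_ne_top_of_section lam hfin hmeas hU ha hsec),
    requestIntensity_apply_of_section cell lam hmeas hU ha hsec,
    Finset.sum_eq_single i (fun i' _ hi' => by simp [U, hi']) (by simp)]
  have hsub : ownRegion cell j ⊆ coverage cell := fun x hx => Set.mem_iUnion.mpr ⟨j, hx.1⟩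
  simp only [U, if_true, Set.inter_eq_left.mpr hsub, ENNReal.toReal_mul, ENNReal.coe_toReal,
    ENNReal.toReal_ofReal (sub_nonneg.mpr hab), mul_assoc]

/-- Two reference configurations matter: the requests are collected in epoch m, under the first, and
the result has to persist in the next epoch, up to τ, under the second. -/
theorem ae_eq_of_requests [IsProbabilityMeasure μ]
    (hΦ : IsPoissonPointProcess μ (requestIntensity cell lam) Φ)
    (hfin : ∀ j, volume (cell j) ≠ ∞) (hTpos : ∀ k, 0 < T k)
    (hR : IsRealCacheProcess μ cell Φ T V R) (o : Config M N K) :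
    ∀ᵐ ω ∂μ, ∀ (m : ℕ) (τ : ℝ), epoch T (m + 1) ≤ τ → τ < epoch T (m + 2) →
      V (leftSlot (epoch T m)) ω = o → V (leftSlot (epoch T (m + 1))) ω = o →
      (∀ j, ∀ i ∈ o.1 j,
        (Φ ω ∩ ownRequests cell i j (epoch T m) (epoch T (m + 1))).Nonempty) →
      R τ ω = o := by
  filter_upwards [hR.no_request, hR.request, ae_requestsBetween_finite hΦ hfin,
    ae_request_times_injective hΦ hfin] with ω h1 h2 h3 h4 m τ hτ1 hτ2 hV1 hV2 hall
  refine eq_of_all_requested (ρ := fun τ => R τ ω) h3 h4 h1 h2 (epoch_nonneg hTpos m)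
    (fun τ' hτ' => ?_) (fun j i hi => ?_)
  · rcases lt_or_ge τ' (epoch T (m + 1)) with h | h
    · rw [lastEpoch_eq hTpos hτ'.1.le h, hV1]
    · rw [lastEpoch_eq hTpos h (hτ'.2.trans_lt hτ2), hV2]
  · obtain ⟨r, hr, hri, hrx, hrt⟩ := hall j i hi
    exact ⟨r, ⟨hr, hrt.1, hrt.2.trans hτ1⟩, hri, hrx⟩

/-- The real caches follow the virtual caches to the configuration `o`. -/
theorem tendsto_measureReal_real_ne [IsProbabilityMeasure μ]
    (hΦ : IsPoissonPointProcess μ (requestIntensity cell lam) Φ)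
    (hcell : ∀ j, MeasurableSet (cell j)) (hfin : ∀ j, volume (cell j) ≠ ∞)
    (hTpos : ∀ k, 0 < T k) (hTmono : Monotone T) (hT : Tendsto T atTop atTop)
    (hR : IsRealCacheProcess μ cell Φ T V R) {o : Config M N K}
    (hown : ∀ j, 0 < volume (ownRegion cell j)) (hlam : ∀ j, ∀ i ∈ o.1 j, 0 < lam i)
    (hV : Tendsto (fun n => μ.real {ω | V n ω ≠ o}) atTop (𝓝 0)) :
    Tendsto (fun τ => μ.real {ω | R τ ω ≠ o}) atTop (𝓝 0) := by
  let u : ℕ → ℝ := fun l => μ.real {ω | V (leftSlot (epoch T l)) ω ≠ o}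
  let v : ℕ → ℝ := fun m => ∑ j, ∑ i ∈ o.1 j,
    Real.exp (-((lam i : ℝ) * (volume (ownRegion cell j)).toReal * T m))
  have hu : Tendsto u atTop (𝓝 0) := hV.comp (tendsto_leftSlot_epoch hTpos hTmono)
  have hv : Tendsto v atTop (𝓝 0) := by
    have : (0 : ℝ) = ∑ j, ∑ i ∈ o.1 j, 0 := by simp
    rw [this]
    refine tendsto_finsetSum _ fun j _ => tendsto_finsetSum _ fun i hi => ?_
    refine Real.tendsto_exp_atBot.comp (tendsto_neg_atTop_atBot.comp (hT.const_mul_atTop ?_))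
    refine mul_pos (by exact_mod_cast hlam j i hi) (ENNReal.toReal_pos (hown j).ne' ?_)
    exact ne_top_of_le_ne_top (hfin j) (measure_mono Set.inter_subset_left)
  have hbound : ∀ (m : ℕ) (τ : ℝ), epoch T (m + 1) ≤ τ → τ < epoch T (m + 2) →
      μ.real {ω | R τ ω ≠ o} ≤ u m + u (m + 1) + v m := by
    intro m τ hτ1 hτ2
    let E : Set Ω := ({ω | V (leftSlot (epoch T m)) ω ≠ o} ∪
      {ω | V (leftSlot (epoch T (m + 1))) ω ≠ o}) ∪ ⋃ j ∈ (Finset.univ : Finset (Fin N)),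
        ⋃ i ∈ o.1 j, {ω | Φ ω ∩ ownRequests cell i j (epoch T m) (epoch T (m + 1)) = ∅}
    have hsub : {ω | R τ ω ≠ o} ≤ᵐ[μ] E := by
      filter_upwards [ae_eq_of_requests hΦ hfin hTpos hR o] with ω hω hne
      by_contra hE
      have hE' : ω ∉ E := hE
      simp only [E, Set.mem_union, Set.mem_iUnion, Set.mem_ofPred_eq, not_or, not_exists, not_not,
        Finset.mem_univ] at hE'
      refine hne (hω m τ hτ1 hτ2 hE'.1.1 hE'.1.2 fun j i hi => ?_)
      exact Set.nonempty_iff_ne_empty.mpr (hE'.2 j trivial i hi)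
    have h1 : μ.real {ω | R τ ω ≠ o} ≤ μ.real E :=
      ENNReal.toReal_mono (measure_ne_top _ _) (measure_mono_ae hsub)
    refine h1.trans ((measureReal_union_le _ _).trans
      (add_le_add (measureReal_union_le _ _) ?_))
    refine (measureReal_biUnion_finset_le _ _).trans (Finset.sum_le_sum fun j _ => ?_)
    refine (measureReal_biUnion_finset_le _ _).trans (Finset.sum_le_sum fun i _ => ?_)
    rw [measureReal_no_ownRequests hΦ hcell hfin i j (epoch_nonneg hTpos m)
      ((strictMono_epoch hTpos).monotone (Nat.le_succ m)), epoch_succ, add_sub_cancel_left]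
  have hsum : Tendsto (fun m => u m + u (m + 1) + v m) atTop (𝓝 0) := by
    simpa using (hu.add (hu.comp (tendsto_add_atTop_nat 1))).add hv
  rw [Metric.tendsto_atTop] at hsum ⊢
  intro ε hε
  obtain ⟨m₀, hm₀⟩ := hsum ε hε
  refine ⟨epoch T (m₀ + 1), fun τ hτ => ?_⟩
  obtain ⟨l, hl1, hl2⟩ := exists_epoch_le_lt hTpos hTmono ((epoch_nonneg hTpos _).trans hτ)
  have hl : m₀ + 1 < l + 1 := (strictMono_epoch hTpos).lt_iff_lt.mp (lt_of_le_of_lt hτ hl2)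
  obtain ⟨m, rfl⟩ : ∃ m, l = m + 1 := ⟨l - 1, by omega⟩
  have h1 := hm₀ m (by omega)
  have h2 := hbound m τ hl1 hl2
  rw [Real.dist_eq, sub_zero] at h1 ⊢
  rw [abs_of_nonneg measureReal_nonneg]
  exact h2.trans_lt ((le_abs_self _).trans_lt h1)

/-- The configuration can change between a and τ only if a request arrives, which has probability at
most the total rate times τ - a. Continuity provides the integrability in τ without joint
measurability of R. -/
theorem continuousOn_measureReal_real_eq [IsProbabilityMeasure μ]
    (hΦ : IsPoissonPointProcess μ (requestIntensity cell lam) Φ)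
    (hfin : ∀ j, volume (cell j) ≠ ∞) (hR : IsRealCacheProcess μ cell Φ T V R)
    (B : Config M N K) : ContinuousOn (fun τ => μ.real {ω | R τ ω = B}) (Set.Ici 0) := by
  have key : ∀ a τ : ℝ, 0 ≤ a → a ≤ τ →
      |μ.real {ω | R τ ω = B} - μ.real {ω | R a ω = B}| ≤ totalRate cell lam * (τ - a) := by
    intro a τ ha haτ
    rcases haτ.eq_or_lt with rfl | hlt
    · simp
    have hE : μ.real {ω | (Φ ω ∩ timeSlab M a τ).Nonempty} ≤ totalRate cell lam * (τ - a) := by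
      rw [← requestIntensity_timeSlab_toReal lam ha haτ]
      exact hΦ.measureReal_nonempty_le (measurableSet_timeSlab _ _)
        (requestIntensity_timeSlab_ne_top lam hfin ha)
    have hae : ∀ᵐ ω ∂μ, ¬ (Φ ω ∩ timeSlab M a τ).Nonempty → R τ ω = R a ω := by
      filter_upwards [hR.no_request] with ω hω hne
      exact hω a τ ha hlt (Set.not_nonempty_iff_eq_empty.mp hne)
    have h1 : ∀ {F G : Set Ω}, F ≤ᵐ[μ] (G ∪ {ω | (Φ ω ∩ timeSlab M a τ).Nonempty} : Set Ω) →
        μ.real F ≤ μ.real G + μ.real {ω | (Φ ω ∩ timeSlab M a τ).Nonempty} := fun hFG =>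
      (ENNReal.toReal_mono (measure_ne_top _ _) (measure_mono_ae hFG)).trans
        (measureReal_union_le _ _)
    have h2 : μ.real {ω | R τ ω = B} ≤ μ.real {ω | R a ω = B}
        + μ.real {ω | (Φ ω ∩ timeSlab M a τ).Nonempty} := by
      refine h1 ?_
      filter_upwards [hae] with ω hω hB
      by_cases hn : (Φ ω ∩ timeSlab M a τ).Nonempty
      · exact Or.inr hn
      · exact Or.inl ((hω hn).symm.trans hB)
    have h3 : μ.real {ω | R a ω = B} ≤ μ.real {ω | R τ ω = B}
        + μ.real {ω | (Φ ω ∩ timeSlab M a τ).Nonempty} := by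
      refine h1 ?_
      filter_upwards [hae] with ω hω hB
      by_cases hn : (Φ ω ∩ timeSlab M a τ).Nonempty
      · exact Or.inr hn
      · exact Or.inl ((hω hn).trans hB)
    rw [abs_le]
    constructor <;> linarith
  refine (LipschitzOnWith.of_dist_le_mul (K := (totalRate cell lam).toNNReal)
    fun x hx y hy => ?_).continuousOn
  rw [Real.coe_toNNReal _ (totalRate_nonneg cell lam), Real.dist_eq, Real.dist_eq]
  rcases le_total x y with h | h
  · rw [abs_sub_comm, abs_sub_comm x y, abs_of_nonneg (sub_nonneg.mpr h)]
    exact key x y hx h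
  · rw [abs_of_nonneg (sub_nonneg.mpr h)]
    exact key y x hy h

theorem integral_comp_eq_sum [IsProbabilityMeasure μ] {S : Type*} [Fintype S] {X : Ω → S}
    (hX : ∀ A, MeasurableSet {ω | X ω = A}) (w : S → ℝ) :
    ∫ ω, w (X ω) ∂μ = ∑ A, w A * μ.real {ω | X ω = A} := by
  classical
  have e : ∀ ω, w (X ω) = ∑ A, Set.indicator {ω | X ω = A} (fun _ => w A) ω := fun ω => by
    rw [Finset.sum_eq_single (X ω)]
    · simp
    · intro A _ hA
      simp [hA.symm]
    · simp
  simp_rw [e]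
  rw [integral_finsetSum _ fun A _ => (integrable_const (w A)).indicator (hX A)]
  refine Finset.sum_congr rfl fun A _ => ?_
  rw [integral_indicator_const _ (hX A), smul_eq_mul, mul_comm]

end RealCaches

end CellularCaching

/-! ### The theorem -/

open CellularCaching in
theorem theorem6 {Ω : Type*} {mΩ : MeasurableSpace Ω} (μ : Measure Ω) [IsProbabilityMeasure μ]
    {N M K : ℕ} (hN : 0 < N) (hKM : K < M)
    -- the cells and the requests
    (cell : Fin N → Set Plane) (hcell : ∀ j, MeasurableSet (cell j))
    (hfin : ∀ j, volume (cell j) ≠ ∞)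
    (lam : Fin M → ℝ≥0) (Φ : Ω → Set (Request M))
    (hΦ : IsPoissonPointProcess μ (requestIntensity cell lam) Φ)
    -- each cell has a region of positive area that is covered only by itself
    (hown : ∀ j, 0 < volume (cell j ∩ (⋃ n ∈ ({j}ᶜ : Set (Fin N)), cell n)ᶜ))
    -- the optimal configuration is unique
    (huniq : ∃! B : Config M N K, B ∈ maximizers (hitRate μ Φ cell))
    -- the inverse temperature parameter
    (β₀ : ℝ) (hβ₀ : 0 < β₀)
    (hβΔ : β₀ * N * ((⨆ B : Config M N K, hitRate μ Φ cell B) -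
      ⨅ B : Config M N K, hitRate μ Φ cell B) < 1)
    (hβmax : β₀ * (⨆ B : Config M N K, hitRate μ Φ cell B) < 1)
    -- the estimates and the virtual caches
    (ℋ : Filtration ℕ mΩ) (θ : Fin N → Fin M → Finset (Fin N) → ℕ → Ω → ℝ)
    (hθ : ∀ k i s, ∀ᵐ ω ∂μ,
      Tendsto (fun t => θ k i s t ω) atTop (𝓝 ((lam i : ℝ) * regionArea cell s)))
    (V : ℕ → Ω → Config M N K) (hV : IsVirtualCacheProcess μ ℋ cell β₀ θ V)
    -- the real caches
    (T : ℕ → ℝ) (hTpos : ∀ k, 0 < T k) (hTmono : Monotone T) (hT : Tendsto T atTop atTop)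
    (R : ℝ → Ω → Config M N K) (hR : IsRealCacheProcess μ cell Φ T V R) :
    Tendsto (fun t : ℝ =>
        (∫ τ in (0 : ℝ)..t, (μ {ω | R τ ω ∈ maximizers (hitRate μ Φ cell)}).toReal) / t)
      atTop (𝓝 1) ∧
    Tendsto (fun t : ℝ => (∫ τ in (0 : ℝ)..t, ∫ ω, hitRate μ Φ cell (R τ ω) ∂μ) / t)
      atTop (𝓝 (⨆ B : Config M N K, hitRate μ Φ cell B)) := by
  obtain ⟨o, homax, hounique⟩ := huniq
  have hcov := hitRate_eq_coverageRate (K := K) hΦ hcell hfin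
  have hmaxset : ∀ B : Config M N K, B ∈ maximizers (hitRate μ Φ cell) ↔ B = o := fun B =>
    ⟨fun h => hounique B h, fun h => h ▸ homax⟩
  have ho : ∀ A, A ≠ o → coverageRate cell lam A < coverageRate cell lam o := by
    intro A hA
    rw [← hcov, ← hcov]
    refine lt_of_le_of_ne (homax A) fun h => hA (hounique A fun A' => ?_)
    rw [h]
    exact homax A'
  have hfinR : (Set.range fun B : Config M N K => hitRate μ Φ cell B).Finite := Set.finite_range _
  have hne : Nonempty (Config M N K) := ⟨o⟩
  have hsup : (⨆ B : Config M N K, hitRate μ Φ cell B) = hitRate μ Φ cell o :=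
    le_antisymm (ciSup_le homax) (le_ciSup hfinR.bddAbove o)
  have hΔ : ∀ A B : Config M N K, coverageRate cell lam A - coverageRate cell lam B
      ≤ (⨆ B : Config M N K, hitRate μ Φ cell B) - ⨅ B : Config M N K, hitRate μ Φ cell B := by
    intro A B
    rw [← hcov, ← hcov]
    exact sub_le_sub (le_ciSup hfinR.bddAbove A) (ciInf_le hfinR.bddBelow B)
  have hVlim := tendsto_measureReal_virtual_ne hN cell
    (fun i s => (lam i : ℝ) * regionArea cell s) (coverageRate cell lam) o
    (fun j A B h => stationEnergy_sub_coverageRate lam h) ho hΔ hβ₀ hβΔ hθ hV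
  have hRne := tendsto_measureReal_real_ne hΦ hcell hfin hTpos hTmono hT hR hown
    (fun j i hi => lam_pos_of_mem_unique_maximizer hKM ho hi) hVlim
  have hReq : Tendsto (fun τ => μ.real {ω | R τ ω = o}) atTop (𝓝 1) := by
    have h1 : Tendsto (fun τ => 1 - μ.real {ω | R τ ω ≠ o}) atTop (𝓝 (1 - 0)) :=
      tendsto_const_nhds.sub hRne
    rw [sub_zero] at h1
    refine h1.congr' ?_
    filter_upwards [eventually_ge_atTop 0] with τ hτ
    have : {ω | R τ ω ≠ o} = {ω | R τ ω = o}ᶜ := rfl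
    rw [this, probReal_compl_eq_one_sub (hR.measurable_config τ hτ o), sub_sub_cancel]
  have hcont := continuousOn_measureReal_real_eq hΦ hfin hR
  constructor
  · simp_rw [hmaxset]
    exact tendsto_integral_div (hcont o) hReq
  -- There are finitely many configurations, so the expected hit rate converges once the law of R(τ)
  -- concentrates on o.
  · have hlim : Tendsto (fun τ => ∑ B, hitRate μ Φ cell B * μ.real {ω | R τ ω = B}) atTop
        (𝓝 (∑ B, hitRate μ Φ cell B * if B = o then 1 else 0)) := by
      refine tendsto_finsetSum _ fun B _ => Tendsto.const_mul _ ?_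
      split_ifs with hB
      · rw [hB]; exact hReq
      · refine tendsto_of_tendsto_of_tendsto_of_le_of_le tendsto_const_nhds hRne
          (fun τ => measureReal_nonneg) (fun τ => measureReal_mono fun ω hω h => ?_)
        exact hB (hω.symm.trans h)
    have heq : ∑ B, hitRate μ Φ cell B * (if B = o then (1 : ℝ) else 0)
        = ⨆ B : Config M N K, hitRate μ Φ cell B := by
      rw [hsup]; simp
    rw [heq] at hlim
    have hE : ∀ τ, 0 ≤ τ → ∫ ω, hitRate μ Φ cell (R τ ω) ∂μ
        = ∑ B, hitRate μ Φ cell B * μ.real {ω | R τ ω = B} := fun τ hτ =>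
      integral_comp_eq_sum (hR.measurable_config τ hτ) _
    refine tendsto_integral_div ?_ (hlim.congr' ?_)
    · refine ContinuousOn.congr ?_ fun τ hτ => hE τ hτ
      exact continuousOn_finsetSum _ fun B _ => (hcont B).const_mul _
    · filter_upwards [eventually_ge_atTop 0] with τ hτ
      exact (hE τ hτ).symm
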